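/- Consider episodic Markov decision processes with a finite state space $\mathcal S$ of size $S$, a finite action space $\mathcal A$ of size $A\ge 2$, horizon $H\ge 1$, discount $\gamma\in(0,1]$, a fixed initial state $s_1$ and unknown, step-dependent transition probabilities $p_h(s'\mid s,a)$, $h\in\{1,\dots,H\}$. A policy is a family $\pi=(\pi_1,\dots,\pi_H)$ of maps $\mathcal S\to\mathcal A$, and a reward function is a family $r=(r_h(s,a))_{h,s,a}$ with values in $[0,1]$. Let $V_1^\pi(s_1;r)=\mathbb E^\pi\big[\sum_{h=1}^H\gamma^{h-1}r_h(s_h,\pi_h(s_h))\big]$ and $V_1^\star(s_1;r)=\max_\pi V_1^\pi(s_1;r)$. Put $\sigma_k=\sum_{i=0}^{k-1}\gamma^i$. After $t$ episodes, let $n_h^t(s,a)$ be the number of visits of $(s,a)$ in step $h$, and $n_h^t(s,a,s')$ the number of those that were followed by $s'$. Let $\hat p_h^t(s'\mid s,a)=n_h^t(s,a,s')/n_h^t(s,a)$ if $n_h^t(s,a)>0$, and $\hat p_h^t(s'\mid s,a)=1/S$ otherwise. For $\delta\in(0,1)$ let $$\beta(n,\delta)=\log\Big(\frac{2SAH}{\delta}\Big)+(S-1)\log\Big(e\Big(1+\frac{n}{S-1}\Big)\Big)$$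 (if $S=1$, here and below the terms with a factor $S-1$ are read as $0$). Define $\bar E_{H+1}^t=0$ and, for $h=H,\dots,1$, $$\bar E_h^t(s,a)=\min\Big(\gamma\sigma_{H-h},\ \gamma\sigma_{H-h}\sqrt{\tfrac{2\beta(n_h^t(s,a),\delta)}{n_h^t(s,a)}}+\gamma\sum_{s'}\hat p_h^t(s'\mid s,a)\max_b\bar E_{h+1}^t(s',b)\Big),$$ where the second term is $+\infty$ if $n_h^t(s,a)=0$. For $\varepsilon>0$, the algorithm Reward-Free UCRL plays episode $t+1$ from $s_1$ with a policy $\pi^{t+1}$ such that $\pi_h^{t+1}(s)\in\operatorname{argmax}_a\bar E_h^t(s,a)$ for all $h,s$ (ties are broken by an arbitrary deterministic rule that depends on the data of the first $t$ episodes), and it stops after $\tau=\inf\{t\in\{0,1,2,\dots\}:\bar E_1^t(s_1,\pi_1^{t+1}(s_1))\le\varepsilon/2\}$ episodes. **Theorem.** Let $\varepsilon>0$ and $\delta\in(0,1)$. 1. Reward-Free UCRL is $(\varepsilon,\delta)$-PAC for reward-free exploration: for all transition probabilities, with probability at least $1-\delta$, $\tau$ is finite and, for all reward functions $r$ simultaneously,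 every policy $\hat\pi$ that is optimal (in every step and state) in the MDP with transitions $\hat p^\tau$ and reward $r$ satisfies $|V_1^\star(s_1;r)-V_1^{\hat\pi}(s_1;r)|\le\varepsilon$. 2. Let $\mathcal C_H=144(1+\sqrt2)^2\sigma_H^4$ and suppose that $\varepsilon^2\le\mathcal C_HSA$ (for instance $\varepsilon\le\sigma_H$). Then, for all transition probabilities, with probability at least $1-\delta$, the property of part 1 holds and moreover $\tau\le B$, where $$B=\frac{\mathcal C_HSA}{\varepsilon^2}\left[\log\Big(\frac{2SAH}{\delta}\Big)+2(S-1)\log\left(\frac{\mathcal C_HSA}{\varepsilon^2}\Big(\log\Big(\frac{2SAH}{\delta}\Big)+(S-1)\Big(\sqrt e+\sqrt{\tfrac{e}{S-1}}\Big)\Big)\right)+(S-1)\right].$$ 3. If $\varepsilon\le H$, then $B$ is, up to an absolute constant, at most $$\frac{SAH^4}{\varepsilon^2}\log\Big(\frac{2SAH}{\delta}\Big)+\frac{S^2AH^4}{\varepsilon^2}\log\Big(\frac{SAH^4}{\varepsilon^2}\log\Big(\frac{2SAH}{\delta}\Big)\Big);$$ the constant $10^5$ is enough. -/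

import Mathlib

open MeasureTheory ProbabilityTheory
open scoped ENNReal

noncomputable section

namespace RewardFree

/-! Steps are numbered from `0`: the index `h : Fin H` stands for step `h + 1` of an episode, and
`Fin.last H : Fin (H + 1)` stands for step `H + 1`, at which the episode is over. -/

/-- Unknown dynamics of a finite episodic MDP: `p h s a s'` is the probability of moving from `s`
to `s'` when playing `a` at step `h`. -/
structure Transitions (S A : Type*) [Fintype S] (H : ℕ) where
  p : Fin H → S → A → S → ℝ
  nonneg : ∀ h s a s', 0 ≤ p h s a s'
  sum_eq_one : ∀ h s a, ∑ s', p h s a s' = 1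

/-- Deterministic, step-dependent policies. -/
abbrev Policy (S A : Type*) (H : ℕ) : Type _ := Fin H → S → A

/-- `σ_k = ∑_{i < k} γ^i`. -/
def sigma (γ : ℝ) (k : ℕ) : ℝ := ∑ i ∈ Finset.range k, γ ^ i

section Value

variable {S A : Type*} [Fintype S] {H : ℕ}

/-- The probability that an episode played with `π` from the state `s` visits the states `z`. -/
def pathProb [DecidableEq S] (p : Fin H → S → A → S → ℝ) (π : Policy S A H) (s : S)
    (z : Fin (H + 1) → S) : ℝ :=
  (if z 0 = s then 1 else 0) *
    ∏ h : Fin H, p h (z h.castSucc) (π h (z h.castSucc)) (z h.succ)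

/-- The value functions `V_h^π(s; r)`, by backward recursion:
`V_{H+1}^π = 0` and `V_h^π(s) = r_h(s, π_h(s)) + γ ∑_{s'} p_h(s' | s, π_h(s)) V_{h+1}^π(s')`.
`value_zero_eq` below identifies `V_1^π` with the expected discounted sum of rewards. -/
def value (γ : ℝ) (p : Fin H → S → A → S → ℝ) (r : Fin H → S → A → ℝ) (π : Policy S A H)
    (h : Fin (H + 1)) : S → ℝ :=
  Fin.reverseInduction (motive := fun _ => S → ℝ) (fun _ => 0)
    (fun h V s => r h s (π h s) + γ * ∑ s', p h s (π h s) s' * V s') h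

/-- The optimal value `V_h^⋆(s; r)`, a supremum over the (finitely many) policies. -/
def optValue (γ : ℝ) (p : Fin H → S → A → S → ℝ) (r : Fin H → S → A → ℝ)
    (h : Fin (H + 1)) (s : S) : ℝ :=
  ⨆ π : Policy S A H, value γ p r π h s

/-- `π` is optimal in the MDP `(p, r)`: it has the largest value in every step and state. -/
def IsOptimal (γ : ℝ) (p : Fin H → S → A → S → ℝ) (r : Fin H → S → A → ℝ)
    (π : Policy S A H) : Prop :=
  ∀ (π' : Policy S A H) (h : Fin (H + 1)) (s : S), value γ p r π' h s ≤ value γ p r π h s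

/-- Rewards have mean in `[0, 1]`. -/
def IsReward (r : Fin H → S → A → ℝ) : Prop :=
  ∀ h s a, 0 ≤ r h s a ∧ r h s a ≤ 1

theorem sum_path_succ [DecidableEq S] (p : Fin (H + 1) → S → A → S → ℝ)
    (π : Policy S A (H + 1)) (s : S) (F : (Fin (H + 2) → S) → ℝ) :
    ∑ z, pathProb p π s z * F z =
      ∑ s', p 0 s (π 0 s) s' * ∑ w, pathProb (fun h => p h.succ) (fun h => π h.succ) s' w *
        F (Fin.cons s w) := by
  have e := (Fin.consEquiv (fun _ : Fin (H + 2) => S)).sum_comp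
    (fun z => pathProb p π s z * F z)
  rw [← e, Fintype.sum_prod_type]
  simp only [Fin.consEquiv_apply, pathProb, Fin.cons_zero, Fin.prod_univ_succ, Fin.castSucc_zero,
    Fin.cons_succ, ← Fin.succ_castSucc]
  rw [Finset.sum_eq_single s]
  · simp only [if_true, one_mul, Finset.mul_sum]
    rw [Finset.sum_comm]
    refine Finset.sum_congr rfl fun w _ => ?_
    rw [Finset.sum_eq_single (w 0)]
    · simp only [if_true, one_mul]
      rw [← mul_assoc]
      rfl
    · intro b _ hb
      simp [Ne.symm hb]
    · simp
  · intro b _ hb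
    simp [hb]
  · simp

theorem sum_pathProb [DecidableEq S] : ∀ {H : ℕ} (M : Transitions S A H) (π : Policy S A H)
    (s : S), ∑ z, pathProb M.p π s z = 1
  | 0, M, π, s => by
    have e := (Equiv.funUnique (Fin 1) S).symm.sum_comp (fun z => pathProb M.p π s z)
    rw [← e]
    simp [pathProb]
  | H + 1, M, π, s => by
    have h := sum_path_succ M.p π s (fun _ => 1)
    simp only [mul_one] at h
    rw [h]
    have ih := fun s' => sum_pathProb (H := H)
      ⟨fun h => M.p h.succ, fun h => M.nonneg h.succ, fun h => M.sum_eq_one h.succ⟩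
      (fun h => π h.succ) s'
    simp only [ih, mul_one, M.sum_eq_one]

theorem value_succ (γ : ℝ) (p : Fin (H + 1) → S → A → S → ℝ) (r : Fin (H + 1) → S → A → ℝ)
    (π : Policy S A (H + 1)) (h : Fin (H + 1)) :
    value γ p r π h.succ =
      value γ (fun h => p h.succ) (fun h => r h.succ) (fun h => π h.succ) h := by
  induction h using Fin.reverseInduction with
  | last => simp [value]
  | cast i ih =>
    unfold value at ih ⊢
    rw [Fin.succ_castSucc, Fin.reverseInduction_castSucc, Fin.reverseInduction_castSucc, ih]

/-- `V_1^π(s; r)` is the expectation of `∑_h γ^{h-1} r_h(s_h, π_h(s_h))` over an episode played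
with `π` from `s`. -/
theorem value_zero_eq [DecidableEq S] (γ : ℝ) : ∀ {H : ℕ} (M : Transitions S A H)
    (r : Fin H → S → A → ℝ) (π : Policy S A H) (s : S),
    value γ M.p r π 0 s = ∑ z, pathProb M.p π s z *
      ∑ h : Fin H, γ ^ (h : ℕ) * r h (z h.castSucc) (π h (z h.castSucc))
  | 0, M, r, π, s => by
    have h0 : value γ M.p r π (Fin.last 0) s = 0 := by
      rw [value, Fin.reverseInduction_last]
    rw [show (0 : Fin (0 + 1)) = Fin.last 0 from rfl, h0]
    simp
  | H + 1, M, r, π, s => by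
    have h1 := value_succ γ M.p r π 0
    have h0 : value γ M.p r π (Fin.castSucc 0) s =
        r 0 s (π 0 s) + γ * ∑ s', M.p 0 s (π 0 s) s' * value γ M.p r π (Fin.succ 0) s' := by
      simp only [value, Fin.reverseInduction_castSucc]
    have hz : (0 : Fin (H + 2)) = Fin.castSucc 0 := rfl
    let M' : Transitions S A H :=
      ⟨fun h => M.p h.succ, fun h => M.nonneg h.succ, fun h => M.sum_eq_one h.succ⟩
    have ih := fun s' => value_zero_eq γ M' (fun h => r h.succ) (fun h => π h.succ) s'
    have hs := fun s' => sum_pathProb M' (fun h => π h.succ) s'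
    rw [sum_path_succ]
    rw [hz, h0, h1]
    simp only [Fin.sum_univ_succ, Fin.castSucc_zero, Fin.cons_zero, Fin.cons_succ,
      ← Fin.succ_castSucc, Fin.val_zero, pow_zero, one_mul, Fin.val_succ, pow_succ', mul_add,
      Finset.sum_add_distrib, ← Finset.sum_mul]
    change _ = ∑ s', M.p 0 s (π 0 s) s' * ((∑ w, pathProb M'.p _ s' w) * _) + _
    simp only [hs, one_mul, ← Finset.sum_mul, M.sum_eq_one]
    congr 1
    rw [Finset.mul_sum]
    refine Finset.sum_congr rfl fun s' _ => ?_
    rw [show value γ (fun h => M.p h.succ) (fun h => r h.succ) (fun h => π h.succ) 0 s' = _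
      from ih s']
    simp only [Finset.mul_sum]
    refine Finset.sum_congr rfl fun w _ => Finset.sum_congr rfl fun h _ => ?_
    ring

/-- Optimal policies exist; in particular in every empirical MDP. -/
theorem exists_isOptimal [Finite A] [Nonempty A] {γ : ℝ} (hγ : 0 ≤ γ) : ∀ {H : ℕ}
    (p : Fin H → S → A → S → ℝ) (_ : ∀ h s a s', 0 ≤ p h s a s') (r : Fin H → S → A → ℝ),
    ∃ π : Policy S A H, IsOptimal γ p r π
  | 0, p, _, r => ⟨fun h => h.elim0, fun π' h s => by
      rw [show π' = fun h => h.elim0 from funext fun h => h.elim0]⟩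
  | H + 1, p, hp, r => by
    obtain ⟨π₁, h₁⟩ := exists_isOptimal hγ (fun h => p h.succ) (fun h => hp h.succ)
      (fun h => r h.succ)
    choose f hf using fun s => Finite.exists_max fun a => r 0 s a + γ * ∑ s', p 0 s a s' *
      value γ (fun h => p h.succ) (fun h => r h.succ) π₁ 0 s'
    have hval : ∀ (π : Policy S A (H + 1)) s, value γ p r π 0 s =
        r 0 s (π 0 s) + γ * ∑ s', p 0 s (π 0 s) s' *
          value γ (fun h => p h.succ) (fun h => r h.succ) (fun h => π h.succ) 0 s' := by
      intro π s
      rw [← value_succ, show (0 : Fin (H + 1 + 1)) = Fin.castSucc 0 from rfl]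
      simp only [value, Fin.reverseInduction_castSucc]
    refine ⟨Fin.cons f π₁, fun π' h s => ?_⟩
    induction h using Fin.cases with
    | zero =>
      rw [hval, hval]
      refine le_trans ?_ (hf s (π' 0 s))
      gcongr with s' _
      · exact hp _ _ _ _
      · exact h₁ _ 0 s'
    | succ h =>
      rw [value_succ, value_succ]
      exact h₁ _ h s

end Value

section Data

variable {S A : Type*} {H : ℕ}

/-- A reward-free episode: the states `s_1, …, s_{H+1}` and the actions `a_1, …, a_H`. -/
@[ext]
structure Episode (S A : Type*) (H : ℕ) where
  state : Fin (H + 1) → S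
  action : Fin H → A

instance : MeasurableSpace (Episode S A H) := ⊤

instance : DiscreteMeasurableSpace (Episode S A H) := ⟨fun _ => trivial⟩

instance [Finite S] [Finite A] : Finite (Episode S A H) :=
  Finite.of_injective (fun z : Episode S A H => (z.state, z.action)) fun x y h => by
    rw [Prod.mk.injEq] at h
    exact Episode.ext h.1 h.2

/-- A database of `t` episodes. -/
abbrev Dataset (S A : Type*) (H t : ℕ) : Type _ := Fin t → Episode S A H

variable [DecidableEq S] [DecidableEq A] {t : ℕ}

/-- `n_h^t(s, a)`. -/
def count (D : Dataset S A H t) (h : Fin H) (s : S) (a : A) : ℕ :=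
  (Finset.univ.filter fun i : Fin t =>
    (D i).state h.castSucc = s ∧ (D i).action h = a).card

/-- `n_h^t(s, a, s')`. -/
def countNext (D : Dataset S A H t) (h : Fin H) (s : S) (a : A) (s' : S) : ℕ :=
  (Finset.univ.filter fun i : Fin t =>
    (D i).state h.castSucc = s ∧ (D i).action h = a ∧ (D i).state h.succ = s').card

/-- The empirical transitions `p̂_h^t(s' | s, a)`. -/
def empirical [Fintype S] (D : Dataset S A H t) (h : Fin H) (s : S) (a : A) (s' : S) : ℝ :=
  if count D h s a = 0 then 1 / (Fintype.card S : ℝ)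
  else (countNext D h s a s' : ℝ) / (count D h s a : ℝ)

end Data

section Interaction

variable {S A : Type*} [Fintype S] [DecidableEq S] [Fintype A] {H : ℕ}

/-- The law of an episode played with `π` from the state `s₁`. -/
def episodeLaw (M : Transitions S A H) (s₁ : S) (π : Policy S A H) : PMF (Episode S A H) :=
  (PMF.ofFintype (fun z : Fin (H + 1) → S => ENNReal.ofReal (pathProb M.p π s₁ z)) (by
    rw [← ENNReal.ofReal_sum_of_nonneg, sum_pathProb, ENNReal.ofReal_one]
    intro z _
    exact mul_nonneg (by split_ifs <;> norm_num)
      (Finset.prod_nonneg fun _ _ => M.nonneg _ _ _ _))).map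
    fun z => ⟨z, fun h => π h (z h.castSucc)⟩

/-- An algorithm for reward-free exploration: from the `t` episodes collected so far it computes
the policy of the next episode, and it decides whether to stop. -/
structure Algorithm (S A : Type*) (H : ℕ) where
  policy : (t : ℕ) → Dataset S A H t → Policy S A H
  halts : (t : ℕ) → Dataset S A H t → Prop

/-- The conditional law of episode `n + 2`, given the first `n + 1` episodes. -/
def nextEpisode (alg : Algorithm S A H) (M : Transitions S A H) (s₁ : S) (n : ℕ) :
    Kernel ((i : Finset.Iic n) → (fun _ : ℕ => Episode S A H) i) (Episode S A H) :=
  Kernel.ofFunOfCountable fun x =>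
    (episodeLaw M s₁ (alg.policy (n + 1) fun i : Fin (n + 1) =>
      x ⟨i, Finset.mem_Iic.2 (Nat.lt_succ_iff.1 i.2)⟩)).toMeasure

instance (alg : Algorithm S A H) (M : Transitions S A H) (s₁ : S) (n : ℕ) :
    IsMarkovKernel (nextEpisode alg M s₁ n) :=
  ⟨fun _ => PMF.toMeasure.isProbabilityMeasure (episodeLaw M s₁ _)⟩

/-- The law of the infinite sequence of episodes that the sampling rule of `alg` generates in the
MDP with dynamics `M` and initial state `s₁` (when the stopping rule is ignored); `ω i` is
episode `i + 1`. -/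
def interactionLaw (alg : Algorithm S A H) (M : Transitions S A H) (s₁ : S) :
    Measure (ℕ → Episode S A H) :=
  Kernel.trajMeasure (X := fun _ : ℕ => Episode S A H)
    (episodeLaw M s₁ (alg.policy 0 Fin.elim0)).toMeasure (nextEpisode alg M s₁)

/-- The first `t` episodes. -/
def dataset (ω : ℕ → Episode S A H) (t : ℕ) : Dataset S A H t := fun i => ω i

/-- `τ = t`: the algorithm stops after exactly `t` episodes. -/
def StopsAt (alg : Algorithm S A H) (ω : ℕ → Episode S A H) (t : ℕ) : Prop :=
  alg.halts t (dataset ω t) ∧ ∀ u < t, ¬ alg.halts u (dataset ω u)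

variable [DecidableEq A]

/-- For all reward functions simultaneously, the policies that are optimal in the empirical MDP
built from `D` are `ε`-optimal from `s₁` in the true MDP. -/
def PlansWell (γ : ℝ) (M : Transitions S A H) (s₁ : S) (ε : ℝ) {t : ℕ}
    (D : Dataset S A H t) : Prop :=
  ∀ r : Fin H → S → A → ℝ, IsReward r → ∀ π : Policy S A H, IsOptimal γ (empirical D) r π →
    |optValue γ M.p r 0 s₁ - value γ M.p r π 0 s₁| ≤ ε

/-- `(ε, δ)`-PAC algorithms for reward-free exploration: in every MDP, with probability at least
`1 - δ`, the algorithm stops and its final database allows to plan `ε`-optimally. -/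
def IsPAC (γ : ℝ) (s₁ : S) (ε δ : ℝ) (alg : Algorithm S A H) : Prop :=
  ∀ M : Transitions S A H, ENNReal.ofReal (1 - δ) ≤ interactionLaw alg M s₁
    {ω | ∃ t, StopsAt alg ω t ∧ PlansWell γ M s₁ ε (dataset ω t)}

/-- The error bounds `Ē_h^t(s, a)` for the threshold `β`, by backward recursion. For `h : Fin H`
(that is, step `h + 1`) the remaining number of steps is `H - 1 - h`. If `n_h^t(s, a) = 0`, then
the second term of the minimum is read as `+∞`. -/
def errorBound (γ : ℝ) (β : ℕ → ℝ) {t : ℕ} (D : Dataset S A H t) (h : Fin (H + 1)) : S → A → ℝ :=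
  Fin.reverseInduction (motive := fun _ => S → A → ℝ) (fun _ _ => 0)
    (fun h E s a =>
      if count D h s a = 0 then γ * sigma γ (H - 1 - h)
      else min (γ * sigma γ (H - 1 - h))
        (γ * sigma γ (H - 1 - h) * √(2 * β (count D h s a) / (count D h s a : ℝ)) +
          γ * ∑ s', empirical D h s a s' * ⨆ b, E s' b)) h

/-- Reward-Free UCRL with threshold `β`: play greedily with respect to the error bounds (with any
rule to break ties), and stop as soon as the error bound of the action played in `s₁` at the first
step is at most `ε / 2`. -/
structure IsRFUCRL [NeZero H] (γ : ℝ) (β : ℕ → ℝ) (s₁ : S) (ε : ℝ) (alg : Algorithm S A H) :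
    Prop where
  greedy : ∀ (t : ℕ) (D : Dataset S A H t) (h : Fin H) (s : S) (b : A),
    errorBound γ β D h.castSucc s b ≤ errorBound γ β D h.castSucc s (alg.policy t D h s)
  halts_iff : ∀ (t : ℕ) (D : Dataset S A H t),
    alg.halts t D ↔ errorBound γ β D 0 s₁ (alg.policy t D 0 s₁) ≤ ε / 2

end Interaction

/-- `β(n, δ) = log(2SAH/δ) + (S-1) log(e(1 + n/(S-1)))`; the second term is `0` if `S = 1`. -/
def threshold (S A H : ℕ) (δ : ℝ) (n : ℕ) : ℝ :=
  Real.log (2 * S * A * H / δ) +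
    ((S : ℝ) - 1) * Real.log (Real.exp 1 * (1 + n / ((S : ℝ) - 1)))

/-- `C_H = 144 (1 + √2)² σ_H⁴`. -/
def constC (γ : ℝ) (H : ℕ) : ℝ := 144 * (1 + √2) ^ 2 * sigma γ H ^ 4

/-- The upper bound on the number of episodes; the terms with a factor `S - 1` are `0`
if `S = 1`. -/
def sampleBound (S A H : ℕ) (γ ε δ : ℝ) : ℝ :=
  constC γ H * S * A / ε ^ 2 *
    (Real.log (2 * S * A * H / δ) +
      2 * ((S : ℝ) - 1) * Real.log (constC γ H * S * A / ε ^ 2 *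
        (Real.log (2 * S * A * H / δ) +
          ((S : ℝ) - 1) * (√(Real.exp 1) + √(Real.exp 1 / ((S : ℝ) - 1))))) +
      ((S : ℝ) - 1))

end RewardFree

end

noncomputable section

namespace RewardFree

/-! ### Functions of the first episodes of an infinite sequence -/

section Sequences

variable {S A : Type*} {H : ℕ}

/-! The proof isolates a good event of probability at least `1 - δ`; everything else is
deterministic on it. Write `L = log(2SAH/δ)`, `n` for the number of visits of a triple `(h, s, a)`,
and `m` for its pseudo-count, the sum of the conditional visit probabilities. The good event asks,
for all numbers of episodes and all triples, that `p̂(B) - p(B) ≤ √(2β(n)/n)` for every set `B` of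
states (if `n > 0`), and that `n ≥ m/2 - L`. Both come from exponential supermartingales and Ville's
inequality (`chernoff_uniform`), hence need no union over time. The first rests on Hoeffding's lemma
and a union over the `2^S` sets and the values of `n`, which the growth of `β` pays for
(`measure_inaccurate_le`, `measure_good_ge`).

Correctness: deviations on all sets control `∑ (p̂ - p) V` for every bounded `V`. By backward
induction `max_b Ē` dominates the error on the value of every policy for every reward
(`Accurate.abs_value_sub_le`). Stopping at `ε/2` therefore costs at most `ε` in planning.

Sample complexity: replacing `p̂` by `p` in the recursion doubles the bonus, and unrolling bounds
`Ē_1` by the expected widths along an episode of the greedy policy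
(`Accurate.iSup_errorBound_le_sum`). Summing over the episodes before stopping, with `n` replaced by
`m`, the widths telescope like square roots, and Cauchy–Schwarz gives `T ε² ≤ C_H S A β(T)`
(`mul_sq_le_threshold`). This inequality is logarithmic in `T` on the right; a crude polynomial
bound on `T`, inserted in the logarithm, solves it (`le_sampleBound`). If `ε² > C_H S A`, the
algorithm stops before any episode. -/

/-- Extend a dataset to an infinite sequence of episodes. -/
def extend {t : ℕ} (z : Episode S A H) (D : Dataset S A H t) : ℕ → Episode S A H :=
  fun i => if h : i < t then D ⟨i, h⟩ else z

theorem dataset_extend_dataset (z : Episode S A H) (ω : ℕ → Episode S A H) {t u : ℕ} (h : u ≤ t) :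
    dataset (extend z (dataset ω t)) u = dataset ω u := by
  funext i
  simp [dataset, extend, i.2.trans_le h]

theorem measurable_dataset (t : ℕ) :
    Measurable (fun ω : ℕ → Episode S A H => dataset ω t) := by
  unfold dataset; fun_prop

/-- The product of the first `t` increments `ψ`. -/
def incrementProd (ψ : (t : ℕ) → Dataset S A H t → Episode S A H → ℝ≥0∞) (t : ℕ)
    (ω : ℕ → Episode S A H) : ℝ≥0∞ :=
  ∏ u ∈ Finset.range t, ψ u (dataset ω u) (ω u)

theorem incrementProd_extend (ψ : (t : ℕ) → Dataset S A H t → Episode S A H → ℝ≥0∞)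
    (z : Episode S A H) (ω : ℕ → Episode S A H) {t u : ℕ} (h : u ≤ t) :
    incrementProd ψ u (extend z (dataset ω t)) = incrementProd ψ u ω := by
  refine Finset.prod_congr rfl fun v hv => ?_
  have hv' := Finset.mem_range.1 hv
  rw [dataset_extend_dataset z ω (hv'.le.trans h)]
  simp [extend, dataset, hv'.trans_le h]

end Sequences

/-! ### The Markov property and Ville's inequality -/

section Markov

variable {S A : Type*} [Fintype S] [DecidableEq S] [Fintype A] {H : ℕ}

instance (alg : Algorithm S A H) (M : Transitions S A H) (s₁ : S) :
    IsProbabilityMeasure (interactionLaw alg M s₁) := by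
  unfold interactionLaw; infer_instance

/-- The first episode of the interaction is played with the initial policy. -/
theorem map_eval_zero_interactionLaw (alg : Algorithm S A H) (M : Transitions S A H) (s₁ : S) :
    (interactionLaw alg M s₁).map (fun ω => ω 0) =
      (episodeLaw M s₁ (alg.policy 0 Fin.elim0)).toMeasure := by
  have key : ∀ (μ₀ : Measure (Episode S A H)),
      (Kernel.trajMeasure (X := fun _ : ℕ => Episode S A H) μ₀ (nextEpisode alg M s₁)).map
        (fun ω => ω 0) = μ₀ := by
    intro μ₀
    have h0 : (fun ω : ℕ → Episode S A H => ω 0) =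
        (fun x : (i : Finset.Iic 0) → (fun _ : ℕ => Episode S A H) i => x default) ∘
          Preorder.frestrictLe (π := fun _ : ℕ => Episode S A H) 0 := rfl
    rw [h0, ← Measure.map_map (by fun_prop) (by fun_prop), Kernel.trajMeasure,
      Measure.map_comp _ _ (by fun_prop), Kernel.traj_map_frestrictLe_of_le le_rfl,
      Measure.deterministic_comp_eq_map, Measure.map_map (by fun_prop) (by fun_prop),
      Measure.map_map (by fun_prop) (by fun_prop)]
    exact Measure.map_id
  exact key _

/-- The Markov property of the interaction: given the first `t` episodes, the next one has the law
of an episode played with the policy that the algorithm chooses. -/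
theorem lintegral_next (alg : Algorithm S A H) (M : Transitions S A H) (s₁ : S) (t : ℕ)
    (F : Dataset S A H t → Episode S A H → ℝ≥0∞) :
    ∫⁻ ω, F (dataset ω t) (ω t) ∂interactionLaw alg M s₁ =
      ∫⁻ ω, ∫⁻ z, F (dataset ω t) z
        ∂(episodeLaw M s₁ (alg.policy t (dataset ω t))).toMeasure ∂interactionLaw alg M s₁ := by
  cases t with
  | zero =>
    have h0 : ∀ ω : ℕ → Episode S A H, dataset ω 0 = Fin.elim0 := fun ω => Subsingleton.elim _ _
    simp only [h0, lintegral_const, measure_univ, mul_one]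
    rw [← map_eval_zero_interactionLaw, lintegral_map (measurable_of_countable _) (by fun_prop)]
  | succ n =>
    let e : ((i : Finset.Iic n) → (fun _ : ℕ => Episode S A H) i) → Dataset S A H (n + 1) :=
      fun x i => x ⟨i, Finset.mem_Iic.2 (Nat.lt_succ_iff.1 i.2)⟩
    let G : ((i : Finset.Iic n) → (fun _ : ℕ => Episode S A H) i) × Episode S A H → ℝ≥0∞ :=
      fun x => F (e x.1) x.2
    have hG : Measurable G := measurable_of_countable _
    have h1 := Kernel.map_frestrictLe_trajMeasure_compProd_eq_map_trajMeasure
      (X := fun _ : ℕ => Episode S A H)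
      (μ₀ := (episodeLaw M s₁ (alg.policy 0 Fin.elim0)).toMeasure)
      (κ := nextEpisode alg M s₁) (a := n)
    change ((interactionLaw alg M s₁).map _) ⊗ₘ _ = (interactionLaw alg M s₁).map _ at h1
    have h2 : ∫⁻ ω, F (dataset ω (n + 1)) (ω (n + 1)) ∂interactionLaw alg M s₁ =
        ∫⁻ x, G x ∂((interactionLaw alg M s₁).map
          (fun x => (Preorder.frestrictLe (π := fun _ : ℕ => Episode S A H) n x, x (n + 1)))) := by
      rw [lintegral_map hG (by fun_prop)]
      rfl
    rw [h2, ← h1, Measure.lintegral_compProd hG,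
      lintegral_map (measurable_of_countable _) (by fun_prop)]
    rfl

/-- Ville's maximal inequality, over a finite number of episodes. -/
theorem ville_finite (alg : Algorithm S A H) (M : Transitions S A H) (s₁ : S)
    (ψ : (t : ℕ) → Dataset S A H t → Episode S A H → ℝ≥0∞)
    (hψ : ∀ t D, ∫⁻ z, ψ t D z ∂(episodeLaw M s₁ (alg.policy t D)).toMeasure ≤ 1)
    (c : ℝ≥0∞) (T : ℕ) :
    c * interactionLaw alg M s₁ {ω | ∃ t ≤ T, c ≤ incrementProd ψ t ω} ≤ 1 := by
  classical
  set μ := interactionLaw alg M s₁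
  let hit : ℕ → Set (ℕ → Episode S A H) := fun T => {ω | ∃ t ≤ T, c ≤ incrementProd ψ t ω}
  -- The process is frozen at `c` once it has reached level `c`. The frozen process still has
  -- expectation at most `1`, and it is at least `c` on the event to be bounded.
  let Φ : ℕ → (ℕ → Episode S A H) → ℝ≥0∞ := fun T ω => if ω ∈ hit T then c else incrementProd ψ T ω
  obtain ⟨ω₀⟩ : Nonempty (ℕ → Episode S A H) := nonempty_of_isProbabilityMeasure μ
  -- Padding with an arbitrary episode makes the event a function of the finite dataset;
  -- measurability and the Markov property both need this form.
  have hhit : ∀ t ω, extend (ω₀ 0) (dataset ω t) ∈ hit t ↔ ω ∈ hit t := by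
    intro t ω
    refine exists_congr fun u => and_congr_right fun hu => ?_
    rw [incrementProd_extend ψ _ _ hu]
  have hΦ : ∀ t ω, Φ t (extend (ω₀ 0) (dataset ω t)) = Φ t ω := by
    intro t ω
    simp only [Φ, hhit, incrementProd_extend ψ _ _ le_rfl]
  have hmeas : ∀ t, Measurable (Φ t) := by
    intro t
    have : Φ t = (fun D : Dataset S A H t => Φ t (extend (ω₀ 0) D)) ∘ fun ω => dataset ω t := by
      funext ω; exact (hΦ t ω).symm
    rw [this]
    exact (measurable_of_countable _).comp (measurable_dataset t)
  have step : ∀ t, ∫⁻ ω, Φ t ω ∂μ ≤ 1 := by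
    intro t
    induction t with
    | zero =>
      calc ∫⁻ ω, Φ 0 ω ∂μ ≤ ∫⁻ _, 1 ∂μ := by
            refine lintegral_mono fun ω => ?_
            by_cases h : ω ∈ hit 0
            · obtain ⟨t, ht, hc⟩ := h
              have : ω ∈ hit 0 := ⟨t, ht, hc⟩
              obtain rfl : t = 0 := by omega
              simpa [Φ, this, incrementProd] using hc
            · simp [Φ, h, incrementProd]
        _ = 1 := by simp
    | succ t ih =>
      refine le_trans ?_ ih
      let F : Dataset S A H t → Episode S A H → ℝ≥0∞ := fun D z =>
        if extend (ω₀ 0) D ∈ hit t then c else incrementProd ψ t (extend (ω₀ 0) D) * ψ t D z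
      calc ∫⁻ ω, Φ (t + 1) ω ∂μ ≤ ∫⁻ ω, F (dataset ω t) (ω t) ∂μ := by
            refine lintegral_mono fun ω => ?_
            simp only [F, hhit, incrementProd_extend ψ _ _ le_rfl]
            by_cases h : ω ∈ hit t
            · have h' : ω ∈ hit (t + 1) := by
                obtain ⟨u, hu, hc⟩ := h
                exact ⟨u, by omega, hc⟩
              simp [Φ, h, h']
            · have hp : incrementProd ψ (t + 1) ω = incrementProd ψ t ω * ψ t (dataset ω t) (ω t) := by
                simp [incrementProd, Finset.prod_range_succ]
              by_cases h' : ω ∈ hit (t + 1)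
              · simp only [Φ, h, h', if_true, if_false]
                obtain ⟨u, hu, hc⟩ := h'
                have : u = t + 1 := by
                  by_contra hne
                  exact h ⟨u, by omega, hc⟩
                subst this
                exact hc.trans_eq hp
              · simp [Φ, h, h', hp]
        _ = _ := lintegral_next alg M s₁ t F
        _ ≤ ∫⁻ ω, Φ t ω ∂μ := by
            refine lintegral_mono fun ω => ?_
            simp only [F, hhit, incrementProd_extend ψ _ _ le_rfl]
            by_cases h : ω ∈ hit t
            · have : IsProbabilityMeasure
                  (episodeLaw M s₁ (alg.policy t (dataset ω t))).toMeasure := inferInstance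
              simp [Φ, h]
            · simp only [Φ, h, if_false]
              rw [lintegral_const_mul _ (measurable_of_countable _)]
              exact mul_le_of_le_one_right' (hψ t _)
  have hset : MeasurableSet (hit T) := by
    have : hit T = (fun ω => dataset ω T) ⁻¹' {D | extend (ω₀ 0) D ∈ hit T} := by
      ext ω; exact (hhit T ω).symm
    rw [this]
    exact measurable_dataset T (Set.to_countable _).measurableSet
  calc c * μ (hit T) = ∫⁻ ω, (hit T).indicator (fun _ => c) ω ∂μ := by
        rw [lintegral_indicator_const hset]
    _ ≤ ∫⁻ ω, Φ T ω ∂μ := by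
        refine lintegral_mono fun ω => ?_
        by_cases h : ω ∈ hit T <;> simp [Φ, h]
    _ ≤ 1 := step T

/-- Ville's maximal inequality for nonnegative supermartingales in product form. -/
theorem ville (alg : Algorithm S A H) (M : Transitions S A H) (s₁ : S)
    (ψ : (t : ℕ) → Dataset S A H t → Episode S A H → ℝ≥0∞)
    (hψ : ∀ t D, ∫⁻ z, ψ t D z ∂(episodeLaw M s₁ (alg.policy t D)).toMeasure ≤ 1)
    (c : ℝ≥0∞) :
    interactionLaw alg M s₁ {ω | ∃ t, c ≤ incrementProd ψ t ω} ≤ c⁻¹ := by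
  have h : {ω | ∃ t, c ≤ incrementProd ψ t ω} = ⋃ T, {ω | ∃ t ≤ T, c ≤ incrementProd ψ t ω} := by
    ext ω
    simp only [Set.mem_ofPred_eq, Set.mem_iUnion]
    exact ⟨fun ⟨t, ht⟩ => ⟨t, t, le_rfl, ht⟩, fun ⟨_, t, _, ht⟩ => ⟨t, ht⟩⟩
  have hmono : Monotone fun T => {ω | ∃ t ≤ T, c ≤ incrementProd ψ t ω} :=
    fun T T' hT ω ⟨t, ht, hω⟩ => ⟨t, ht.trans hT, hω⟩
  rw [h, hmono.measure_iUnion]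
  refine iSup_le fun T => ?_
  rw [ENNReal.le_inv_iff_mul_le, mul_comm]
  exact ville_finite alg M s₁ ψ hψ c T

end Markov

/-! ### Episode probabilities and a time-uniform Chernoff bound -/

section Paths

variable {S A : Type*} [Fintype S] [DecidableEq S] {H : ℕ}

theorem pathProb_nonneg (M : Transitions S A H) (π : Policy S A H) (s : S)
    (z : Fin (H + 1) → S) : 0 ≤ pathProb M.p π s z :=
  mul_nonneg (by split_ifs <;> norm_num) (Finset.prod_nonneg fun _ _ => M.nonneg _ _ _ _)

/-- The transition at step `h` of an episode follows `p h`. -/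
theorem sum_pathProb_mul_step : ∀ {H : ℕ} (M : Transitions S A H) (π : Policy S A H) (s : S)
    (h : Fin H) (F : S → S → ℝ),
    ∑ z, pathProb M.p π s z * F (z h.castSucc) (z h.succ) =
      ∑ z, pathProb M.p π s z *
        ∑ s', M.p h (z h.castSucc) (π h (z h.castSucc)) s' * F (z h.castSucc) s'
  | 0, _, _, _, h, _ => h.elim0
  | H + 1, M, π, s, h, F => by
    let M' : Transitions S A H :=
      ⟨fun h => M.p h.succ, fun h => M.nonneg h.succ, fun h => M.sum_eq_one h.succ⟩
    rw [sum_path_succ, sum_path_succ]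
    induction h using Fin.cases with
    | zero =>
      have hs := fun s' => sum_pathProb M' (fun h => π h.succ) s'
      have e : ∀ s' (w : Fin (H + 1) → S),
          pathProb M'.p (fun h => π h.succ) s' w * F s (w 0) =
            pathProb M'.p (fun h => π h.succ) s' w * F s s' := by
        intro s' w
        by_cases h : w 0 = s'
        · rw [h]
        · simp [pathProb, h]
      change ∑ s', M.p 0 s (π 0 s) s' *
          ∑ w, pathProb M'.p (fun h => π h.succ) s' w * F s (w 0) =
        ∑ s', M.p 0 s (π 0 s) s' * ∑ w, pathProb M'.p (fun h => π h.succ) s' w *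
          ∑ s', M.p 0 s (π 0 s) s' * F s s'
      simp only [e, ← Finset.sum_mul, hs, one_mul, M.sum_eq_one]
    | succ h =>
      refine Finset.sum_congr rfl fun s' _ => ?_
      congr 1
      simp only [Fin.cons_succ, ← Fin.succ_castSucc]
      exact sum_pathProb_mul_step M' (fun h => π h.succ) s' h F

/-- The probability that an episode played with `π` visits `(s, a)` at step `h`. -/
def visitProb [DecidableEq A] (M : Transitions S A H) (s₁ : S) (π : Policy S A H) (h : Fin H)
    (s : S) (a : A) : ℝ :=
  ∑ z, pathProb M.p π s₁ z *
    if z h.castSucc = s ∧ π h (z h.castSucc) = a then 1 else 0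

theorem visitProb_nonneg [DecidableEq A] (M : Transitions S A H) (s₁ : S) (π : Policy S A H)
    (h : Fin H) (s : S) (a : A) : 0 ≤ visitProb M s₁ π h s a :=
  Finset.sum_nonneg fun _ _ => mul_nonneg (pathProb_nonneg _ _ _ _) (by split_ifs <;> norm_num)

theorem visitProb_le_one [DecidableEq A] (M : Transitions S A H) (s₁ : S) (π : Policy S A H)
    (h : Fin H) (s : S) (a : A) : visitProb M s₁ π h s a ≤ 1 := by
  rw [← sum_pathProb M π s₁]
  refine Finset.sum_le_sum fun z _ => mul_le_of_le_one_right (pathProb_nonneg _ _ _ _) ?_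
  split_ifs <;> norm_num

theorem sum_visitProb_mul [Fintype A] [DecidableEq A] (M : Transitions S A H) (s₁ : S)
    (π : Policy S A H) (h : Fin H) (g : S → A → ℝ) :
    ∑ s, ∑ a, visitProb M s₁ π h s a * g s a =
      ∑ z, pathProb M.p π s₁ z * g (z h.castSucc) (π h (z h.castSucc)) := by
  simp only [visitProb, Finset.sum_mul]
  rw [← Fintype.sum_prod_type' (f := fun s a => ∑ z, pathProb M.p π s₁ z *
    (if z h.castSucc = s ∧ π h (z h.castSucc) = a then 1 else 0) * g s a), Finset.sum_comm]
  refine Finset.sum_congr rfl fun z _ => ?_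
  rw [Finset.sum_eq_single (z h.castSucc, π h (z h.castSucc))]
  · simp
  · rintro ⟨s, a⟩ _ hne
    rw [if_neg]
    · simp
    · rintro ⟨rfl, rfl⟩; exact hne rfl
  · simp

theorem sum_visitProb [Fintype A] [DecidableEq A] (M : Transitions S A H) (s₁ : S)
    (π : Policy S A H) (h : Fin H) : ∑ s, ∑ a, visitProb M s₁ π h s a = 1 := by
  simpa [sum_pathProb] using sum_visitProb_mul M s₁ π h fun _ _ => 1

variable [Fintype A]

theorem lintegral_episodeLaw (M : Transitions S A H) (s₁ : S) (π : Policy S A H)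
    (g : Episode S A H → ℝ) (hg : ∀ z, 0 ≤ g z) :
    ∫⁻ z, ENNReal.ofReal (g z) ∂(episodeLaw M s₁ π).toMeasure =
      ENNReal.ofReal (∑ z, pathProb M.p π s₁ z * g ⟨z, fun h => π h (z h.castSucc)⟩) := by
  let _ : MeasurableSpace (Fin (H + 1) → S) := ⊤
  rw [episodeLaw, ← PMF.toMeasure_map _ _ (measurable_of_countable _),
    lintegral_map (measurable_of_countable _) (measurable_of_countable _), lintegral_fintype,
    ENNReal.ofReal_sum_of_nonneg fun z _ => mul_nonneg (pathProb_nonneg _ _ _ _) (hg _)]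
  refine Finset.sum_congr rfl fun z _ => ?_
  rw [PMF.toMeasure_apply_singleton _ _ (measurableSet_singleton z), PMF.ofFintype_apply,
    ENNReal.ofReal_mul (pathProb_nonneg _ _ _ _), mul_comm]

/-- A Chernoff bound, uniform in the number of episodes. -/
theorem chernoff_uniform (alg : Algorithm S A H) (M : Transitions S A H) (s₁ : S)
    (φ : (t : ℕ) → Dataset S A H t → Episode S A H → ℝ)
    (hφ : ∀ t D, ∑ z, pathProb M.p (alg.policy t D) s₁ z *
      Real.exp (φ t D ⟨z, fun h => alg.policy t D h (z h.castSucc)⟩) ≤ 1) (x : ℝ) :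
    interactionLaw alg M s₁
        {ω | ∃ t, x ≤ ∑ u ∈ Finset.range t, φ u (dataset ω u) (ω u)} ≤
      ENNReal.ofReal (Real.exp (-x)) := by
  have h := ville alg M s₁ (fun t D z => ENNReal.ofReal (Real.exp (φ t D z)))
    (fun t D => by
      rw [lintegral_episodeLaw M s₁ _ _ fun z => (Real.exp_pos _).le]
      exact ENNReal.ofReal_le_one.2 (hφ t D)) (ENNReal.ofReal (Real.exp x))
  rw [Real.exp_neg, ENNReal.ofReal_inv_of_pos (Real.exp_pos x)]
  refine le_trans (measure_mono ?_) h
  rintro ω ⟨t, ht⟩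
  refine ⟨t, ?_⟩
  rw [incrementProd, ← ENNReal.ofReal_prod_of_nonneg fun _ _ => (Real.exp_pos _).le, ← Real.exp_sum]
  exact ENNReal.ofReal_le_ofReal (Real.exp_le_exp.2 ht)

end Paths

section Hoeffding

variable {S : Type*} [Fintype S]

/-- Hoeffding's lemma on a finite space. -/
theorem sum_mul_exp_le (q : S → ℝ) (hq : ∀ s, 0 ≤ q s) (hq1 : ∑ s, q s = 1) (f : S → ℝ)
    (hf : ∀ s, 0 ≤ f s ∧ f s ≤ 1) (l : ℝ) :
    ∑ s, q s * Real.exp (l * (f s - ∑ s', q s' * f s')) ≤ Real.exp (l ^ 2 / 8) := by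
  let _ : MeasurableSpace S := ⊤
  let P : PMF S := PMF.ofFintype (fun s => ENNReal.ofReal (q s)) (by
    rw [← ENNReal.ofReal_sum_of_nonneg fun s _ => hq s, hq1, ENNReal.ofReal_one])
  have hP : ∀ g : S → ℝ, ∫ s, g s ∂P.toMeasure = ∑ s, q s * g s := by
    intro g
    rw [PMF.integral_eq_sum]
    simp [P, ENNReal.toReal_ofReal (hq _)]
  have h := (hasSubgaussianMGF_of_mem_Icc (μ := P.toMeasure) (X := f) (a := 0) (b := 1)
    (measurable_of_countable f).aemeasurable (Filter.Eventually.of_forall fun s => hf s)).mgf_le l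
  rw [mgf, hP, hP] at h
  refine h.trans_eq ?_
  congr 1
  simp
  ring

end Hoeffding

/-! ### Visit counts and the empirical dynamics -/

section Counts

variable {S A : Type*} [DecidableEq S] [DecidableEq A] {H : ℕ}

theorem count_dataset (ω : ℕ → Episode S A H) (t : ℕ) (h : Fin H) (s : S) (a : A) :
    (count (dataset ω t) h s a : ℝ) = ∑ u ∈ Finset.range t,
      if (ω u).state h.castSucc = s ∧ (ω u).action h = a then 1 else 0 := by
  rw [count, Finset.card_filter, Nat.cast_sum, ← Fin.sum_univ_eq_sum_range (fun u =>
    if (ω u).state h.castSucc = s ∧ (ω u).action h = a then (1 : ℝ) else 0) t]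
  refine Finset.sum_congr rfl fun u _ => ?_
  by_cases hu : (ω u).state h.castSucc = s ∧ (ω u).action h = a
  · rw [if_pos hu, if_pos (by exact hu), Nat.cast_one]
  · rw [if_neg hu, if_neg (by exact hu), Nat.cast_zero]

theorem countNext_dataset (ω : ℕ → Episode S A H) (t : ℕ) (h : Fin H) (s : S) (a : A) (s' : S) :
    (countNext (dataset ω t) h s a s' : ℝ) = ∑ u ∈ Finset.range t,
      if (ω u).state h.castSucc = s ∧ (ω u).action h = a ∧ (ω u).state h.succ = s'
        then 1 else 0 := by
  rw [countNext, Finset.card_filter, Nat.cast_sum, ← Fin.sum_univ_eq_sum_range (fun u =>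
    if (ω u).state h.castSucc = s ∧ (ω u).action h = a ∧ (ω u).state h.succ = s'
      then (1 : ℝ) else 0) t]
  refine Finset.sum_congr rfl fun u _ => ?_
  by_cases hu : (ω u).state h.castSucc = s ∧ (ω u).action h = a ∧ (ω u).state h.succ = s'
  · rw [if_pos hu, if_pos (by exact hu), Nat.cast_one]
  · rw [if_neg hu, if_neg (by exact hu), Nat.cast_zero]

theorem sum_countNext [Fintype S] {t : ℕ} (D : Dataset S A H t) (h : Fin H) (s : S) (a : A) :
    ∑ s', countNext D h s a s' = count D h s a := by
  simp only [countNext, count, Finset.card_filter]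
  rw [Finset.sum_comm]
  refine Finset.sum_congr rfl fun i _ => ?_
  by_cases hi : (D i).state h.castSucc = s ∧ (D i).action h = a
  · simp [hi.1, hi.2]
  · rw [if_neg hi]
    exact Finset.sum_eq_zero fun s' _ => if_neg fun ⟨h1, h2, _⟩ => hi ⟨h1, h2⟩

theorem empirical_nonneg [Fintype S] {t : ℕ} (D : Dataset S A H t) (h : Fin H) (s : S) (a : A)
    (s' : S) : 0 ≤ empirical D h s a s' := by
  unfold empirical; split_ifs <;> positivity

theorem sum_empirical [Fintype S] [Nonempty S] {t : ℕ} (D : Dataset S A H t) (h : Fin H) (s : S)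
    (a : A) : ∑ s', empirical D h s a s' = 1 := by
  unfold empirical
  split_ifs with hn
  · simp
  · rw [← Finset.sum_div, ← Nat.cast_sum, sum_countNext, div_self (by exact_mod_cast hn)]

/-- The empirical dynamics, as dynamics. -/
def empiricalTransitions [Fintype S] [Nonempty S] {t : ℕ} (D : Dataset S A H t) :
    Transitions S A H :=
  ⟨empirical D, empirical_nonneg D, sum_empirical D⟩

theorem count_le {t : ℕ} (D : Dataset S A H t) (h : Fin H) (s : S) (a : A) :
    count D h s a ≤ t := by
  simpa [count] using Finset.card_filter_le (Finset.univ : Finset (Fin t))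
    (fun i => (D i).state h.castSucc = s ∧ (D i).action h = a)

end Counts

/-! ### Concentration of visit counts and of empirical transitions -/

section Concentration

variable {S A : Type*} [Fintype S] [DecidableEq S] [Fintype A] [DecidableEq A] {H : ℕ}

/-- The expected number of visits of `(s, a)` at step `h`, given the policies that were played. -/
def pseudoCount (alg : Algorithm S A H) (M : Transitions S A H) (s₁ : S)
    (ω : ℕ → Episode S A H) (t : ℕ) (h : Fin H) (s : S) (a : A) : ℝ :=
  ∑ u ∈ Finset.range t, visitProb M s₁ (alg.policy u (dataset ω u)) h s a

/-- The estimates of the transition probabilities of all sets of states are accurate. -/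
def Accurate (M : Transitions S A H) (β : ℕ → ℝ) {t : ℕ} (D : Dataset S A H t) : Prop :=
  ∀ h s a, count D h s a ≠ 0 → ∀ B : Finset S,
    ∑ s' ∈ B, (empirical D h s a s' - M.p h s a s') ≤ √(2 * β (count D h s a) / count D h s a)

/-- If `X` is the indicator of a visit, of conditional probability `q`, then `E exp(q/2 - X) =
exp(q/2) (1 - (1 - 1/e) q) ≤ 1`, because `1 - 1/e ≥ 1/2`. The Chernoff bound applies to these
increments. -/
theorem measure_undercount_le (alg : Algorithm S A H) (M : Transitions S A H) (s₁ : S)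
    (h : Fin H) (s : S) (a : A) (L : ℝ) :
    interactionLaw alg M s₁
        {ω | ∃ t, L ≤ pseudoCount alg M s₁ ω t h s a / 2 - count (dataset ω t) h s a} ≤
      ENNReal.ofReal (Real.exp (-L)) := by
  have key := chernoff_uniform alg M s₁ (fun t D z =>
    visitProb M s₁ (alg.policy t D) h s a / 2 -
      if z.state h.castSucc = s ∧ z.action h = a then 1 else 0) (fun t D => by
    set π := alg.policy t D
    set q := visitProb M s₁ π h s a with hq
    have e : ∀ z : Fin (H + 1) → S, pathProb M.p π s₁ z *
        Real.exp (q / 2 - if z h.castSucc = s ∧ π h (z h.castSucc) = a then 1 else 0) =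
        Real.exp (q / 2) * (pathProb M.p π s₁ z - (1 - Real.exp (-1)) * (pathProb M.p π s₁ z *
          if z h.castSucc = s ∧ π h (z h.castSucc) = a then 1 else 0)) := by
      intro z
      split_ifs
      · rw [sub_eq_add_neg, Real.exp_add]; ring
      · simp; ring
    simp only [e, ← Finset.mul_sum, Finset.sum_sub_distrib, sum_pathProb]
    change Real.exp (q / 2) * (1 - (1 - Real.exp (-1)) * q) ≤ 1
    have hq0 : 0 ≤ q := visitProb_nonneg _ _ _ _ _ _
    have h1 : Real.exp (-1) ≤ 1 / 2 := by
      rw [Real.exp_neg, ← one_div]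
      exact one_div_le_one_div_of_le (by norm_num) (by linarith [Real.exp_one_gt_d9])
    have h2 : 1 - (1 - Real.exp (-1)) * q ≤ Real.exp (-(q / 2)) := by
      have := Real.add_one_le_exp (-(q / 2))
      nlinarith
    calc _ ≤ Real.exp (q / 2) * Real.exp (-(q / 2)) := by gcongr
      _ = 1 := by rw [← Real.exp_add]; simp) L
  refine le_trans (measure_mono ?_) key
  rintro ω ⟨t, ht⟩
  refine ⟨t, ?_⟩
  rwa [Finset.sum_sub_distrib, ← count_dataset, ← Finset.sum_div]

/-- Fixing the value `n` of the count makes the width `x = √(2β/n)` deterministic, so that a single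
exponential supermartingale can be tuned to it. The number of episodes stays free. -/
theorem measure_deviation_le (alg : Algorithm S A H) (M : Transitions S A H) (s₁ : S)
    (h : Fin H) (s : S) (a : A) (B : Finset S) {n : ℕ} (hn : n ≠ 0) {β : ℝ} (hβ : 0 ≤ β) :
    interactionLaw alg M s₁ {ω | ∃ t, count (dataset ω t) h s a = n ∧
        √(2 * β / n) < ∑ s' ∈ B, (empirical (dataset ω t) h s a s' - M.p h s a s')} ≤
      ENNReal.ofReal (Real.exp (-(4 * β))) := by
  set x := √(2 * β / n) with hx
  set P := ∑ s', M.p h s a s' * (if s' ∈ B then 1 else 0) with hP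
  have hn' : (0 : ℝ) < n := by positivity
  have hx2 : x ^ 2 * n = 2 * β := by
    rw [hx, Real.sq_sqrt (by positivity)]; field_simp
  -- The slope `4x` is optimal in Hoeffding's bound: after `n` visits with deviation `x`, the sum is
  -- at least `4x · nx - n (4x)²/8 = 2nx² = 4β`.
  have key := chernoff_uniform alg M s₁ (fun _ _ z =>
    if z.state h.castSucc = s ∧ z.action h = a then
      4 * x * ((if z.state h.succ ∈ B then 1 else 0) - P) - (4 * x) ^ 2 / 8 else 0) (fun t D => by
    set π := alg.policy t D
    have e := sum_pathProb_mul_step M π s₁ h (fun y y' => Real.exp (if y = s ∧ π h y = a then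
      4 * x * ((if y' ∈ B then 1 else 0) - P) - (4 * x) ^ 2 / 8 else 0))
    refine e.trans_le ?_
    refine (Finset.sum_le_sum fun z _ =>
      mul_le_of_le_one_right (pathProb_nonneg _ _ _ _) ?_).trans_eq (sum_pathProb M π s₁)
    split_ifs with hz
    · obtain ⟨hz1, hz2⟩ := hz
      rw [hz2, hz1]
      have hh := sum_mul_exp_le (M.p h s a) (M.nonneg h s a) (M.sum_eq_one h s a)
        (fun s' => if s' ∈ B then 1 else 0) (fun s' => by split_ifs <;> norm_num) (4 * x)
      simp only [sub_eq_add_neg _ ((4 * x) ^ 2 / 8), Real.exp_add, ← mul_assoc, ← Finset.sum_mul]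
      calc _ ≤ Real.exp ((4 * x) ^ 2 / 8) * Real.exp (-((4 * x) ^ 2 / 8)) := by
            gcongr
        _ = 1 := by rw [← Real.exp_add]; simp
    · simp [M.sum_eq_one]) (4 * β)
  refine le_trans (measure_mono ?_) key
  rintro ω ⟨t, ht, hdev⟩
  refine ⟨t, ?_⟩
  have hc : (count (dataset ω t) h s a : ℝ) = n := by rw [ht]
  have h1 : ∑ u ∈ Finset.range t, (if (ω u).state h.castSucc = s ∧ (ω u).action h = a then
      4 * x * ((if (ω u).state h.succ ∈ B then 1 else 0) - P) - (4 * x) ^ 2 / 8 else 0) =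
      4 * x * (∑ s' ∈ B, (countNext (dataset ω t) h s a s' : ℝ) -
        count (dataset ω t) h s a * P) - count (dataset ω t) h s a * ((4 * x) ^ 2 / 8) := by
    simp only [countNext_dataset, count_dataset]
    rw [Finset.sum_comm]
    simp only [Finset.sum_mul, ← Finset.sum_sub_distrib, Finset.mul_sum]
    refine Finset.sum_congr rfl fun u _ => ?_
    by_cases hu : (ω u).state h.castSucc = s ∧ (ω u).action h = a
    · simp [hu.1, hu.2]
    · rw [if_neg hu, if_neg hu, Finset.sum_eq_zero]
      · ring
      · intro s' _
        rw [if_neg fun ⟨h1, h2, _⟩ => hu ⟨h1, h2⟩]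
  have h2 : ∑ s' ∈ B, (empirical (dataset ω t) h s a s' - M.p h s a s') =
      (∑ s' ∈ B, (countNext (dataset ω t) h s a s' : ℝ)) / n - P := by
    rw [Finset.sum_sub_distrib, Finset.sum_div]
    congr 1
    · refine Finset.sum_congr rfl fun s' _ => ?_
      rw [empirical, if_neg (by omega), hc]
    · simp [hP]
  rw [h2] at hdev
  have h3 : n * x ≤ ∑ s' ∈ B, (countNext (dataset ω t) h s a s' : ℝ) - n * P := by
    have h4 := mul_le_mul_of_nonneg_left hdev.le hn'.le
    rwa [mul_sub, mul_div_cancel₀ _ hn'.ne'] at h4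
  have h5 : 0 ≤ 4 * x := by positivity
  have h6 := mul_le_mul_of_nonneg_left h3 h5
  rw [h1, hc]
  nlinarith

end Concentration

/-! ### Calibration of the threshold and the good event -/

section Threshold

/-- Bernoulli's inequality `(1 + n/(S-1))^(S-1) ≥ 1 + n` extracts from the threshold the two terms
that pay for the union bounds: `S - 1` for the sets of states, `log(1 + n)` for the counts. -/
theorem threshold_ge {S A H : ℕ} (hS : 2 ≤ S) (δ : ℝ) (n : ℕ) :
    Real.log (2 * S * A * H / δ) + ((S : ℝ) - 1) + Real.log (1 + n) ≤ threshold S A H δ n := by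
  obtain ⟨k, rfl⟩ : ∃ k, S = k + 1 := ⟨S - 1, by omega⟩
  have hk : (0 : ℝ) < k := by
    have : 0 < k := by omega
    exact_mod_cast this
  have e : ((k + 1 : ℕ) : ℝ) - 1 = k := by push_cast; ring
  rw [threshold, e, Real.log_mul (Real.exp_pos 1).ne' (by positivity), Real.log_exp, mul_add,
    mul_one, ← Real.log_pow, add_assoc]
  gcongr
  have := one_add_mul_le_pow (a := (n : ℝ) / k) (by linarith [show (0 : ℝ) ≤ n / k by positivity]) k
  rwa [mul_div_cancel₀ _ hk.ne'] at this

theorem threshold_nonneg {S A H : ℕ} (hS : 1 ≤ S) {δ : ℝ}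
    (hL : 0 ≤ Real.log (2 * S * A * H / δ)) (n : ℕ) : 0 ≤ threshold S A H δ n := by
  have h1 : (0 : ℝ) ≤ S - 1 := by
    have : (1 : ℝ) ≤ S := by exact_mod_cast hS
    linarith
  have h2 : 1 ≤ Real.exp 1 * (1 + n / ((S : ℝ) - 1)) := by
    have h3 : 0 ≤ (n : ℝ) / ((S : ℝ) - 1) := by positivity
    have h4 := Real.add_one_le_exp 1
    nlinarith
  exact add_nonneg hL (mul_nonneg h1 (Real.log_nonneg h2))

theorem two_pow_mul_exp_threshold_le {S A H : ℕ} (hS : 2 ≤ S) {δ : ℝ}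
    (hL : 0 ≤ Real.log (2 * S * A * H / δ)) {n : ℕ} (hn : n ≠ 0) :
    2 ^ S * Real.exp (-(4 * threshold S A H δ n)) ≤
      Real.exp (-Real.log (2 * S * A * H / δ)) / 4 * (1 / (n : ℝ) ^ 2) := by
  have h := threshold_ge (A := A) (H := H) hS δ n
  set L := Real.log (2 * S * A * H / δ)
  have hn' : (1 : ℝ) ≤ n := by exact_mod_cast Nat.one_le_iff_ne_zero.2 hn
  obtain ⟨k, rfl⟩ : ∃ k, S = k + 2 := ⟨S - 2, by omega⟩
  -- Of `4β`, one `L` is kept for the confidence level, `4(S-1)` beats `2^S`, and `2 log(1 + n)`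
  -- makes the sum over `n` converge.
  have h1 : Real.exp (-(4 * threshold (k + 2) A H δ n)) ≤
      Real.exp (-L) * Real.exp (-(4 * (k + 1))) * Real.exp (-(2 * Real.log (1 + n))) := by
    rw [← Real.exp_add, ← Real.exp_add, Real.exp_le_exp]
    have := Real.log_nonneg (show (1 : ℝ) ≤ 1 + n by linarith)
    push_cast at h
    linarith
  have h2 : Real.exp (-(2 * Real.log (1 + n))) ≤ 1 / (n : ℝ) ^ 2 := by
    rw [Real.exp_neg, ← Real.log_rpow (by positivity), Real.exp_log (by positivity), ← one_div]
    refine one_div_le_one_div_of_le (by positivity) ?_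
    rw [Real.rpow_two]
    gcongr
    linarith
  have h3 : 2 ^ (k + 2) * Real.exp (-(4 * (k + 1))) ≤ 1 / 4 := by
    have h4 : (2 : ℝ) ^ (4 * (k + 1)) ≤ Real.exp (4 * (k + 1)) := by
      have : Real.exp (4 * (k + 1)) = Real.exp 1 ^ (4 * (k + 1)) := by
        rw [← Real.exp_nat_mul]; congr 1; push_cast; ring
      rw [this]
      gcongr
      linarith [Real.exp_one_gt_d9]
    rw [Real.exp_neg, ← div_eq_mul_inv, div_le_iff₀ (Real.exp_pos _)]
    have h5 : (2 : ℝ) ^ (k + 4) ≤ 2 ^ (4 * (k + 1)) := by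
      gcongr
      · norm_num
      · omega
    have h6 : (2 : ℝ) ^ (k + 4) = 4 * 2 ^ (k + 2) := by ring
    linarith
  calc _ ≤ 2 ^ (k + 2) * (Real.exp (-L) * Real.exp (-(4 * (k + 1))) *
        Real.exp (-(2 * Real.log (1 + n)))) := by gcongr
    _ = (2 ^ (k + 2) * Real.exp (-(4 * (k + 1)))) * Real.exp (-L) *
        Real.exp (-(2 * Real.log (1 + n))) := by ring
    _ ≤ 1 / 4 * Real.exp (-L) * (1 / (n : ℝ) ^ 2) := by gcongr
    _ = _ := by ring

end Threshold

section GoodEvent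

variable {S A : Type*} [Fintype S] [DecidableEq S] [Fintype A] [DecidableEq A] {H : ℕ}

theorem measure_inaccurate_le (alg : Algorithm S A H) (M : Transitions S A H) (s₁ : S) {δ : ℝ}
    (hL : 0 ≤ Real.log (2 * Fintype.card S * Fintype.card A * H / δ))
    (h : Fin H) (s : S) (a : A) :
    interactionLaw alg M s₁ {ω | ∃ t, count (dataset ω t) h s a ≠ 0 ∧ ∃ B : Finset S,
        √(2 * threshold (Fintype.card S) (Fintype.card A) H δ (count (dataset ω t) h s a) /
          count (dataset ω t) h s a) <
        ∑ s' ∈ B, (empirical (dataset ω t) h s a s' - M.p h s a s')} ≤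
      ENNReal.ofReal (Real.exp (-Real.log (2 * Fintype.card S * Fintype.card A * H / δ))) := by
  set L := Real.log (2 * Fintype.card S * Fintype.card A * H / δ)
  set β := threshold (Fintype.card S) (Fintype.card A) H δ
  have : Nonempty S := ⟨s⟩
  have hS1 : 1 ≤ Fintype.card S := Fintype.card_pos
  rcases hS1.eq_or_lt with hS | hS
  -- With a single state the estimate is exact. This case is separate because the threshold then
  -- does not grow with `n`.
  · have : Subsingleton S := Fintype.card_le_one_iff_subsingleton.1 hS.ge
    have hone : ∀ q : S → ℝ, ∑ s', q s' = 1 → ∀ s', q s' = 1 := by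
      intro q hq s'
      have : Unique S := uniqueOfSubsingleton s'
      rw [Fintype.sum_unique] at hq
      rw [← hq, Subsingleton.elim s' default]
    refine (measure_mono (t := ∅) ?_).trans (by simp)
    rintro ω ⟨t, -, B, hB⟩
    rw [Finset.sum_eq_zero] at hB
    · exact absurd hB (not_lt.2 (Real.sqrt_nonneg _))
    · intro s' _
      rw [hone _ (sum_empirical (dataset ω t) h s a), hone _ (M.sum_eq_one h s a), sub_self]
  · let E : ℕ → Finset S → Set (ℕ → Episode S A H) := fun n B =>
      {ω | n ≠ 0 ∧ ∃ t, count (dataset ω t) h s a = n ∧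
        √(2 * β n / n) < ∑ s' ∈ B, (empirical (dataset ω t) h s a s' - M.p h s a s')}
    have hE : ∀ n, ∑ B, interactionLaw alg M s₁ (E n B) ≤
        ENNReal.ofReal (Real.exp (-L) / 4 * (1 / (n : ℝ) ^ 2)) := by
      intro n
      by_cases hn : n = 0
      · simp [E, hn]
      · calc ∑ B, interactionLaw alg M s₁ (E n B)
            ≤ ∑ _B : Finset S, ENNReal.ofReal (Real.exp (-(4 * β n))) := by
              refine Finset.sum_le_sum fun B _ => ?_
              refine (measure_mono ?_).trans
                (measure_deviation_le alg M s₁ h s a B hn (threshold_nonneg hS1 hL n))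
              exact fun ω hω => hω.2
          _ = ENNReal.ofReal (2 ^ Fintype.card S * Real.exp (-(4 * β n))) := by
              rw [Finset.sum_const, Finset.card_univ, Fintype.card_finset, nsmul_eq_mul,
                ENNReal.ofReal_mul (by positivity), ENNReal.ofReal_pow (by norm_num)]
              simp
          _ ≤ _ := ENNReal.ofReal_le_ofReal (two_pow_mul_exp_threshold_le hS hL hn)
    -- The sum over `n` is `π²/6`, which the factor `1/4` brings below `1`. The term `n = 0`
    -- vanishes, as `1 / 0 = 0`.
    have hsum := hasSum_zeta_two.mul_left (Real.exp (-L) / 4)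
    calc _ ≤ interactionLaw alg M s₁ (⋃ n, ⋃ B, E n B) := by
          refine measure_mono ?_
          rintro ω ⟨t, hn, B, hB⟩
          exact Set.mem_iUnion.2 ⟨_, Set.mem_iUnion.2 ⟨B, hn, t, rfl, hB⟩⟩
      _ ≤ ∑' n, interactionLaw alg M s₁ (⋃ B, E n B) := measure_iUnion_le _
      _ ≤ ∑' n : ℕ, ENNReal.ofReal (Real.exp (-L) / 4 * (1 / (n : ℝ) ^ 2)) :=
          ENNReal.tsum_le_tsum fun n => (measure_iUnion_fintype_le _ _).trans (hE n)
      _ = ENNReal.ofReal (Real.exp (-L) / 4 * (Real.pi ^ 2 / 6)) := by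
          rw [← ENNReal.ofReal_tsum_of_nonneg (fun n => by positivity) hsum.summable, hsum.tsum_eq]
      _ ≤ ENNReal.ofReal (Real.exp (-L)) := by
          refine ENNReal.ofReal_le_ofReal ?_
          have h1 := Real.exp_pos (-L)
          have h2 : Real.pi ^ 2 ≤ 16 := by nlinarith [Real.pi_lt_four, Real.pi_pos]
          nlinarith

/-- With probability at least `1 - δ`, in every number of episodes, the estimated transitions are
accurate and the numbers of visits are not much smaller than their conditional expectations. -/
theorem measure_good_ge (alg : Algorithm S A H) (M : Transitions S A H) (s₁ : S) {δ : ℝ}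
    (hA : 0 < Fintype.card A) (hH : 0 < H) (hδ : 0 < δ)
    (hL : 0 ≤ Real.log (2 * Fintype.card S * Fintype.card A * H / δ)) :
    ENNReal.ofReal (1 - δ) ≤ interactionLaw alg M s₁ {ω | ∀ t,
      Accurate M (threshold (Fintype.card S) (Fintype.card A) H δ) (dataset ω t) ∧
      ∀ h s a, pseudoCount alg M s₁ ω t h s a / 2 - count (dataset ω t) h s a ≤
        Real.log (2 * Fintype.card S * Fintype.card A * H / δ)} := by
  set L := Real.log (2 * Fintype.card S * Fintype.card A * H / δ) with hLdef
  set β := threshold (Fintype.card S) (Fintype.card A) H δ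
  set μ := interactionLaw alg M s₁
  have hS : 0 < Fintype.card S := Fintype.card_pos_iff.2 ⟨s₁⟩
  set G : Set (ℕ → Episode S A H) := {ω | ∀ t, Accurate M β (dataset ω t) ∧
      ∀ h s a, pseudoCount alg M s₁ ω t h s a / 2 - count (dataset ω t) h s a ≤ L} with hG
  have hexp : Real.exp (-L) = δ / (2 * Fintype.card S * Fintype.card A * H) := by
    rw [Real.exp_neg, Real.exp_log (by positivity), inv_div]
  have hbad : μ Gᶜ ≤ ENNReal.ofReal δ := by
    let E : Fin H × S × A → Set (ℕ → Episode S A H) := fun x =>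
      {ω | ∃ t, count (dataset ω t) x.1 x.2.1 x.2.2 ≠ 0 ∧ ∃ B : Finset S,
        √(2 * β (count (dataset ω t) x.1 x.2.1 x.2.2) / count (dataset ω t) x.1 x.2.1 x.2.2) <
        ∑ s' ∈ B, (empirical (dataset ω t) x.1 x.2.1 x.2.2 s' - M.p x.1 x.2.1 x.2.2 s')}
    let F : Fin H × S × A → Set (ℕ → Episode S A H) := fun x =>
      {ω | ∃ t, L ≤ pseudoCount alg M s₁ ω t x.1 x.2.1 x.2.2 / 2 -
        count (dataset ω t) x.1 x.2.1 x.2.2}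
    have hsub : Gᶜ ⊆ ⋃ x, (E x ∪ F x) := by
      intro ω hω
      by_contra hne
      refine hω fun t => ⟨fun h s a hn B => ?_, fun h s a => ?_⟩
      · by_contra hlt
        exact hne (Set.mem_iUnion.2 ⟨(h, s, a), Or.inl ⟨t, hn, B, not_le.1 hlt⟩⟩)
      · by_contra hlt
        exact hne (Set.mem_iUnion.2 ⟨(h, s, a), Or.inr ⟨t, (not_le.1 hlt).le⟩⟩)
    calc μ Gᶜ ≤ ∑ x, μ (E x ∪ F x) := (measure_mono hsub).trans (measure_iUnion_fintype_le _ _)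
      -- Each of the `SAH` triples may fail in two ways, each with probability at most `exp(-L) =
      -- δ/(2SAH)`.
      _ ≤ ∑ _x : Fin H × S × A, ENNReal.ofReal (2 * Real.exp (-L)) := by
          refine Finset.sum_le_sum fun x _ => ?_
          refine (measure_union_le _ _).trans ?_
          rw [two_mul, ENNReal.ofReal_add (Real.exp_pos _).le (Real.exp_pos _).le]
          exact add_le_add (measure_inaccurate_le alg M s₁ hL x.1 x.2.1 x.2.2)
            (measure_undercount_le alg M s₁ x.1 x.2.1 x.2.2 L)
      _ = ENNReal.ofReal δ := by
          rw [Finset.sum_const, nsmul_eq_mul, ← ENNReal.ofReal_natCast,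
            ← ENNReal.ofReal_mul (by positivity), hexp]
          congr 1
          simp only [Finset.card_univ, Fintype.card_prod, Fintype.card_fin, Nat.cast_mul]
          have h1 : (0 : ℝ) < Fintype.card S := by exact_mod_cast hS
          have h2 : (0 : ℝ) < Fintype.card A := by exact_mod_cast hA
          have h3 : (0 : ℝ) < H := by exact_mod_cast hH
          field_simp
  have huniv : 1 ≤ μ G + μ Gᶜ := by
    rw [← measure_univ (μ := μ), ← Set.union_compl_self G]
    exact measure_union_le _ _
  rw [ENNReal.ofReal_sub _ hδ.le, ENNReal.ofReal_one]
  exact tsub_le_iff_right.2 (huniv.trans (by gcongr))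

end GoodEvent

/-! ### Discounted sums, values and error bounds -/

section Sigma

variable {γ : ℝ}

theorem sigma_succ (γ : ℝ) (k : ℕ) : sigma γ (k + 1) = 1 + γ * sigma γ k := by
  simp only [sigma, Finset.sum_range_succ', pow_zero, pow_succ', Finset.mul_sum]
  ring

theorem sigma_nonneg (hγ : 0 ≤ γ) (k : ℕ) : 0 ≤ sigma γ k :=
  Finset.sum_nonneg fun _ _ => pow_nonneg hγ _

theorem sigma_mono (hγ : 0 ≤ γ) : Monotone (sigma γ) := fun _ _ h =>
  Finset.sum_le_sum_of_subset_of_nonneg (Finset.range_mono h) fun _ _ _ => pow_nonneg hγ _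

theorem one_le_sigma (hγ : 0 ≤ γ) {k : ℕ} (hk : 0 < k) : 1 ≤ sigma γ k := by
  simpa [sigma] using sigma_mono hγ hk

theorem sigma_le (hγ : 0 ≤ γ) (hγ1 : γ ≤ 1) (k : ℕ) : sigma γ k ≤ k := by
  simpa [sigma] using Finset.sum_le_card_nsmul (Finset.range k) (fun i => γ ^ i) 1
    fun i _ => pow_le_one₀ hγ hγ1

end Sigma

section Values

variable {S A : Type*} [Fintype S] {H : ℕ} {γ : ℝ}

theorem value_last (γ : ℝ) (p : Fin H → S → A → S → ℝ) (r : Fin H → S → A → ℝ)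
    (π : Policy S A H) (s : S) : value γ p r π (Fin.last H) s = 0 := by
  rw [value, Fin.reverseInduction_last]

theorem value_castSucc (γ : ℝ) (p : Fin H → S → A → S → ℝ) (r : Fin H → S → A → ℝ)
    (π : Policy S A H) (h : Fin H) (s : S) : value γ p r π h.castSucc s =
      r h s (π h s) + γ * ∑ s', p h s (π h s) s' * value γ p r π h.succ s' := by
  simp only [value, Fin.reverseInduction_castSucc]

theorem sum_mul_mem_Icc {q V : S → ℝ} (hq : ∀ s, 0 ≤ q s) (hq1 : ∑ s, q s = 1) {c : ℝ}
    (hV : ∀ s, 0 ≤ V s ∧ V s ≤ c) : 0 ≤ ∑ s, q s * V s ∧ ∑ s, q s * V s ≤ c := by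
  refine ⟨Finset.sum_nonneg fun s _ => mul_nonneg (hq s) (hV s).1, ?_⟩
  calc ∑ s, q s * V s ≤ ∑ s, q s * c :=
        Finset.sum_le_sum fun s _ => mul_le_mul_of_nonneg_left (hV s).2 (hq s)
    _ = c := by rw [← Finset.sum_mul, hq1, one_mul]

theorem value_mem_Icc (hγ : 0 ≤ γ) (M : Transitions S A H) {r : Fin H → S → A → ℝ}
    (hr : IsReward r) (π : Policy S A H) (h : Fin (H + 1)) :
    ∀ s, 0 ≤ value γ M.p r π h s ∧ value γ M.p r π h s ≤ sigma γ (H - h) := by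
  induction h using Fin.reverseInduction with
  | last => intro s; simp [value_last, sigma]
  | cast h ih =>
    intro s
    have h1 := sum_mul_mem_Icc (M.nonneg h s (π h s)) (M.sum_eq_one h s (π h s)) ih
    have h2 := hr h s (π h s)
    have e : H - (h.castSucc : ℕ) = (H - (h.succ : ℕ)) + 1 := by
      have := h.2
      simp only [Fin.val_castSucc, Fin.val_succ]
      omega
    rw [value_castSucc, e, sigma_succ]
    exact ⟨add_nonneg h2.1 (mul_nonneg hγ h1.1),
      add_le_add h2.2 (mul_le_mul_of_nonneg_left h1.2 hγ)⟩

end Values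

section Width

variable {S A : Type*} [DecidableEq S] [DecidableEq A] {H t : ℕ}

/-- The width of the confidence region for the transitions from `(s, a)`, truncated at `1`. -/
def width (β : ℕ → ℝ) (D : Dataset S A H t) (h : Fin H) (s : S) (a : A) : ℝ :=
  if count D h s a = 0 then 1 else √(min (β (count D h s a) / count D h s a) 1)

theorem width_nonneg (β : ℕ → ℝ) (D : Dataset S A H t) (h : Fin H) (s : S) (a : A) :
    0 ≤ width β D h s a := by
  unfold width; split_ifs <;> positivity

end Width

section ErrorBounds

variable {S A : Type*} [Fintype S] [DecidableEq S] [DecidableEq A] {H : ℕ} {γ : ℝ}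
  {β : ℕ → ℝ} {t : ℕ} {D : Dataset S A H t}

theorem errorBound_last (γ : ℝ) (β : ℕ → ℝ) (D : Dataset S A H t) (s : S) (a : A) :
    errorBound γ β D (Fin.last H) s a = 0 := by
  rw [errorBound, Fin.reverseInduction_last]

theorem errorBound_castSucc (γ : ℝ) (β : ℕ → ℝ) (D : Dataset S A H t) (h : Fin H) (s : S) (a : A) :
    errorBound γ β D h.castSucc s a =
      if count D h s a = 0 then γ * sigma γ (H - 1 - h)
      else min (γ * sigma γ (H - 1 - h))
        (γ * sigma γ (H - 1 - h) * √(2 * β (count D h s a) / (count D h s a : ℝ)) +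
          γ * ∑ s', empirical D h s a s' * ⨆ b, errorBound γ β D h.succ s' b) := by
  simp only [errorBound, Fin.reverseInduction_castSucc]

theorem errorBound_castSucc_le (γ : ℝ) (β : ℕ → ℝ) (D : Dataset S A H t) (h : Fin H) (s : S)
    (a : A) : errorBound γ β D h.castSucc s a ≤ γ * sigma γ (H - 1 - h) := by
  rw [errorBound_castSucc]
  split_ifs
  · exact le_rfl
  · exact min_le_left _ _

theorem errorBound_nonneg (hγ : 0 ≤ γ) (β : ℕ → ℝ) (D : Dataset S A H t) (h : Fin (H + 1)) :
    ∀ s a, 0 ≤ errorBound γ β D h s a := by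
  induction h using Fin.reverseInduction with
  | last => intro s a; rw [errorBound_last]
  | cast h ih =>
    intro s a
    have h1 := mul_nonneg hγ (sigma_nonneg hγ (H - 1 - h))
    rw [errorBound_castSucc]
    split_ifs
    · exact h1
    · refine le_min h1 (add_nonneg (mul_nonneg h1 (Real.sqrt_nonneg _)) (mul_nonneg hγ ?_))
      exact Finset.sum_nonneg fun s' _ =>
        mul_nonneg (empirical_nonneg _ _ _ _ _) (Real.iSup_nonneg fun b => ih s' b)

theorem errorBound_le_sigma (hγ : 0 ≤ γ) (β : ℕ → ℝ) (D : Dataset S A H t) (h : Fin (H + 1))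
    (s : S) (a : A) : errorBound γ β D h s a ≤ sigma γ (H - h) := by
  induction h using Fin.reverseInduction with
  | last => rw [errorBound_last]; exact sigma_nonneg hγ _
  | cast h _ =>
    refine (errorBound_castSucc_le γ β D h s a).trans ?_
    have e : H - (h.castSucc : ℕ) = (H - 1 - h) + 1 := by
      have := h.2
      simp only [Fin.val_castSucc]
      omega
    rw [e, sigma_succ]
    linarith

theorem iSup_errorBound_mem_Icc [Nonempty A] (hγ : 0 ≤ γ) (β : ℕ → ℝ) (D : Dataset S A H t)
    (h : Fin (H + 1)) (s : S) : 0 ≤ ⨆ b, errorBound γ β D h s b ∧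
      ⨆ b, errorBound γ β D h s b ≤ sigma γ (H - h) :=
  ⟨Real.iSup_nonneg fun b => errorBound_nonneg hγ β D h s b,
    ciSup_le fun b => errorBound_le_sigma hγ β D h s b⟩

theorem le_iSup_errorBound [Finite A] (γ : ℝ) (β : ℕ → ℝ) (D : Dataset S A H t)
    (h : Fin (H + 1)) (s : S) (a : A) : errorBound γ β D h s a ≤ ⨆ b, errorBound γ β D h s b :=
  le_ciSup (f := fun b => errorBound γ β D h s b) (Set.finite_range _).bddAbove a

/-- The worst `V` with values in `[0, c]` equals `c` where `p̂ ≥ p` and `0` elsewhere, so accuracy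
on that one set `B` suffices. -/
theorem Accurate.sum_le {M : Transitions S A H} (hacc : Accurate M β D) {h : Fin H} {s : S} {a : A}
    (hn : count D h s a ≠ 0) {c : ℝ} {V : S → ℝ} (hV : ∀ s, 0 ≤ V s ∧ V s ≤ c) :
    ∑ s', (empirical D h s a s' - M.p h s a s') * V s' ≤
      c * √(2 * β (count D h s a) / count D h s a) := by
  have hc : 0 ≤ c := (hV s).1.trans (hV s).2
  let B := Finset.univ.filter fun s' => 0 ≤ empirical D h s a s' - M.p h s a s'
  calc ∑ s', (empirical D h s a s' - M.p h s a s') * V s'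
      ≤ ∑ s', if 0 ≤ empirical D h s a s' - M.p h s a s' then
          (empirical D h s a s' - M.p h s a s') * c else 0 := by
        refine Finset.sum_le_sum fun s' _ => ?_
        split_ifs with h0
        · exact mul_le_mul_of_nonneg_left (hV s').2 h0
        · exact mul_nonpos_of_nonpos_of_nonneg (not_le.1 h0).le (hV s').1
    _ = c * ∑ s' ∈ B, (empirical D h s a s' - M.p h s a s') := by
        rw [← Finset.sum_filter, ← Finset.sum_mul, mul_comm]
    _ ≤ _ := mul_le_mul_of_nonneg_left (hacc h s a hn B) hc

theorem Accurate.abs_sum_le {M : Transitions S A H} (hacc : Accurate M β D) {h : Fin H} {s : S}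
    {a : A} (hn : count D h s a ≠ 0) {c : ℝ} {V : S → ℝ} (hV : ∀ s, 0 ≤ V s ∧ V s ≤ c) :
    |∑ s', (empirical D h s a s' - M.p h s a s') * V s'| ≤
      c * √(2 * β (count D h s a) / count D h s a) := by
  have : Nonempty S := ⟨s⟩
  refine abs_le.2 ⟨?_, hacc.sum_le hn hV⟩
  -- Both transition laws have mass `1`, so `V ↦ c - V` changes the sign of the sum and turns the
  -- one-sided bound into a two-sided one.
  have h1 := hacc.sum_le hn (V := fun s' => c - V s') (c := c)
    (fun s' => ⟨by linarith [(hV s').2], by linarith [(hV s').1]⟩)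
  have h2 : ∑ s', (empirical D h s a s' - M.p h s a s') * (c - V s') =
      -∑ s', (empirical D h s a s' - M.p h s a s') * V s' := by
    simp only [mul_sub, Finset.sum_sub_distrib, ← Finset.sum_mul, sum_empirical, M.sum_eq_one]
    ring
  linarith

/-- The error bounds dominate the errors on the values of all policies, for all rewards. -/
theorem Accurate.abs_value_sub_le [Finite A] {M : Transitions S A H} (hacc : Accurate M β D)
    (hγ : 0 ≤ γ) {r : Fin H → S → A → ℝ} (hr : IsReward r) (π : Policy S A H)
    (h : Fin (H + 1)) : ∀ s, |value γ (empirical D) r π h s - value γ M.p r π h s| ≤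
      ⨆ b, errorBound γ β D h s b := by
  induction h using Fin.reverseInduction with
  | last =>
    intro s
    simp [value_last, errorBound_last]
  | cast h ih =>
    intro s
    have : Nonempty S := ⟨s⟩
    refine le_trans ?_ (le_iSup_errorBound γ β D h.castSucc s (π h s))
    set a := π h s with ha
    have e : H - 1 - (h : ℕ) = H - (h.succ : ℕ) := by simp only [Fin.val_succ]; omega
    have hV := value_mem_Icc hγ M hr π h.succ
    have hV' := value_mem_Icc hγ (empiricalTransitions D) hr π h.succ
    rw [← e] at hV hV'
    have h1 := sum_mul_mem_Icc (M.nonneg h s a) (M.sum_eq_one h s a) hV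
    have h2 := sum_mul_mem_Icc (empirical_nonneg D h s a) (sum_empirical D h s a) hV'
    change 0 ≤ ∑ s', _ * value γ (empirical D) r π h.succ s' ∧
      ∑ s', _ * value γ (empirical D) r π h.succ s' ≤ _ at h2
    have hdiff : value γ (empirical D) r π h.castSucc s - value γ M.p r π h.castSucc s =
        γ * (∑ s', empirical D h s a s' * value γ (empirical D) r π h.succ s' -
          ∑ s', M.p h s a s' * value γ M.p r π h.succ s') := by
      rw [value_castSucc, value_castSucc]
      ring
    rw [hdiff, abs_mul, abs_of_nonneg hγ, errorBound_castSucc]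
    have hb : γ * |∑ s', empirical D h s a s' * value γ (empirical D) r π h.succ s' -
          ∑ s', M.p h s a s' * value γ M.p r π h.succ s'| ≤ γ * sigma γ (H - 1 - h) :=
      mul_le_mul_of_nonneg_left (abs_le.2 ⟨by linarith [h1.2, h2.1], by linarith [h1.1, h2.2]⟩) hγ
    split_ifs with hn
    · exact hb
    · refine le_min hb ?_
      -- The model error is charged to the true value function, and the propagated error is averaged
      -- under `p̂`, as in the recursion for `Ē`.
      have hsplit : ∑ s', empirical D h s a s' * value γ (empirical D) r π h.succ s' -
          ∑ s', M.p h s a s' * value γ M.p r π h.succ s' =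
          ∑ s', (empirical D h s a s' - M.p h s a s') * value γ M.p r π h.succ s' +
          ∑ s', empirical D h s a s' *
            (value γ (empirical D) r π h.succ s' - value γ M.p r π h.succ s') := by
        rw [← Finset.sum_sub_distrib, ← Finset.sum_add_distrib]
        exact Finset.sum_congr rfl fun s' _ => by ring
      have h3 := hacc.abs_sum_le hn hV
      have h4 : |∑ s', empirical D h s a s' *
            (value γ (empirical D) r π h.succ s' - value γ M.p r π h.succ s')| ≤
          ∑ s', empirical D h s a s' * ⨆ b, errorBound γ β D h.succ s' b := by
        refine (Finset.abs_sum_le_sum_abs _ _).trans (Finset.sum_le_sum fun s' _ => ?_)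
        rw [abs_mul, abs_of_nonneg (empirical_nonneg _ _ _ _ _)]
        exact mul_le_mul_of_nonneg_left (ih s') (empirical_nonneg _ _ _ _ _)
      rw [hsplit, mul_assoc γ, ← mul_add]
      exact mul_le_mul_of_nonneg_left ((abs_add_le _ _).trans (add_le_add h3 h4)) hγ

/-- Passing from the true to the empirical MDP costs `ε/2` for the competitor and `ε/2` for `π`; in
the empirical MDP `π` is at least as good. -/
theorem Accurate.plansWell [Finite A] [Nonempty A] {M : Transitions S A H}
    (hacc : Accurate M β D) (hγ : 0 ≤ γ) {s₁ : S} {ε : ℝ} (hE : ⨆ b, errorBound γ β D 0 s₁ b ≤ ε / 2) :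
    PlansWell γ M s₁ ε D := by
  intro r hr π hπ
  have hle : ∀ π' : Policy S A H, value γ M.p r π' 0 s₁ ≤ value γ M.p r π 0 s₁ + ε := by
    intro π'
    have h1 := abs_le.1 ((hacc.abs_value_sub_le hγ hr π' 0 s₁).trans hE)
    have h2 := abs_le.1 ((hacc.abs_value_sub_le hγ hr π 0 s₁).trans hE)
    linarith [hπ π' 0 s₁, h1.1, h2.2]
  have h1 : value γ M.p r π 0 s₁ ≤ optValue γ M.p r 0 s₁ :=
    le_ciSup (f := fun π => value γ M.p r π 0 s₁) (Set.finite_range _).bddAbove π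
  have h2 : optValue γ M.p r 0 s₁ ≤ value γ M.p r π 0 s₁ + ε := ciSup_le hle
  rw [abs_of_nonneg (by linarith)]
  linarith

/-- The error bounds satisfy an approximate Bellman inequality in the true MDP. -/
theorem Accurate.errorBound_le [Nonempty A] {M : Transitions S A H} (hacc : Accurate M β D)
    (hγ : 0 ≤ γ) (h : Fin H) (s : S) (a : A) :
    errorBound γ β D h.castSucc s a ≤ γ * sigma γ (H - 1 - h) * (√8 * width β D h s a) +
      γ * ∑ s', M.p h s a s' * ⨆ b, errorBound γ β D h.succ s' b := by
  have hU := iSup_errorBound_mem_Icc hγ β D h.succ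
  have e : H - (h.succ : ℕ) = H - 1 - (h : ℕ) := by simp only [Fin.val_succ]; omega
  rw [e] at hU
  have h1 := sum_mul_mem_Icc (M.nonneg h s a) (M.sum_eq_one h s a) hU
  have hσ := mul_nonneg hγ (sigma_nonneg hγ (H - 1 - h))
  have h8 : (1 : ℝ) ≤ √8 := Real.one_le_sqrt.2 (by norm_num)
  -- Where the width is truncated, the cap `γ σ` in the definition of `Ē` is already enough.
  have htriv : width β D h s a = 1 → errorBound γ β D h.castSucc s a ≤
      γ * sigma γ (H - 1 - h) * (√8 * width β D h s a) +
      γ * ∑ s', M.p h s a s' * ⨆ b, errorBound γ β D h.succ s' b := by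
    intro hw
    rw [hw, mul_one]
    have h2 := errorBound_castSucc_le γ β D h s a
    have h3 := mul_nonneg hγ h1.1
    nlinarith
  by_cases hn : count D h s a = 0
  · exact htriv (by simp [width, hn])
  by_cases hβ : 1 ≤ β (count D h s a) / count D h s a
  · exact htriv (by simp [width, hn, hβ])
  have hw : width β D h s a = √(β (count D h s a) / count D h s a) := by
    rw [width, if_neg hn, min_eq_left (not_le.1 hβ).le]
  have h2 : √(2 * β (count D h s a) / count D h s a) = √2 * width β D h s a := by
    rw [hw, mul_div_assoc, Real.sqrt_mul (by norm_num)]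
  have h3 : √8 = 2 * √2 := by
    rw [show (8 : ℝ) = 2 ^ 2 * 2 by norm_num, Real.sqrt_mul (by norm_num),
      Real.sqrt_sq (by norm_num)]
  have h4 := hacc.sum_le hn hU
  rw [errorBound_castSucc, if_neg hn]
  -- One `√2 · width` is the bonus itself; the other comes from replacing `p̂` by `p` in front of
  -- the next error bound. Together they make `√8`.
  refine (min_le_right _ _).trans ?_
  rw [h2] at h4 ⊢
  simp only [sub_mul, Finset.sum_sub_distrib] at h4
  rw [h3]
  have h5 := mul_le_mul_of_nonneg_left h4 hγ
  linarith

/-- Unrolling the approximate Bellman inequality along the greedy policy is policy evaluation in the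
true MDP, with the widths as rewards. -/
theorem Accurate.iSup_errorBound_le_value [Nonempty A] {M : Transitions S A H}
    (hacc : Accurate M β D) (hγ : 0 ≤ γ) (hγ1 : γ ≤ 1) {π : Policy S A H}
    (hπ : ∀ h s b, errorBound γ β D h.castSucc s b ≤ errorBound γ β D h.castSucc s (π h s))
    (h : Fin (H + 1)) : ∀ s, ⨆ b, errorBound γ β D h s b ≤
      value γ M.p (fun h s a => sigma γ H * (√8 * width β D h s a)) π h s := by
  induction h using Fin.reverseInduction with
  | last => intro s; simp [errorBound_last, value_last]
  | cast h ih =>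
    intro s
    refine (ciSup_le (hπ h s)).trans ?_
    refine (hacc.errorBound_le hγ h s (π h s)).trans ?_
    rw [value_castSucc]
    have h1 : γ * sigma γ (H - 1 - h) ≤ sigma γ H :=
      (mul_le_of_le_one_left (sigma_nonneg hγ _) hγ1).trans (sigma_mono hγ (by omega))
    have h2 := width_nonneg β D h s (π h s)
    refine add_le_add (mul_le_mul_of_nonneg_right h1 (by positivity))
      (mul_le_mul_of_nonneg_left (Finset.sum_le_sum fun s' _ => ?_) hγ)
    exact mul_le_mul_of_nonneg_left (ih s') (M.nonneg _ _ _ _)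

/-- The error bound of a greedy policy is at most the expected sum of the widths that it meets. -/
theorem Accurate.iSup_errorBound_le_sum [Fintype A] [Nonempty A] {M : Transitions S A H}
    (hacc : Accurate M β D) (hγ : 0 ≤ γ) (hγ1 : γ ≤ 1) {π : Policy S A H}
    (hπ : ∀ h s b, errorBound γ β D h.castSucc s b ≤ errorBound γ β D h.castSucc s (π h s))
    (s₁ : S) : ⨆ b, errorBound γ β D 0 s₁ b ≤ sigma γ H * √8 *
      ∑ h : Fin H, γ ^ (h : ℕ) * ∑ s, ∑ a, visitProb M s₁ π h s a * width β D h s a := by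
  refine (hacc.iSup_errorBound_le_value hγ hγ1 hπ 0 s₁).trans_eq ?_
  simp only [value_zero_eq, sum_visitProb_mul, Finset.mul_sum]
  rw [Finset.sum_comm]
  refine Finset.sum_congr rfl fun h _ => Finset.sum_congr rfl fun z _ => ?_
  ring

end ErrorBounds

/-! ### The sum of the widths over the episodes -/

section SumOfWidths

/-- Since `z = (√(x+z) - √x)(√(x+z) + √x)`, and the last factor is at most `(1 + √2) √(max x 1)`
when `z ≤ 1`, the sum over episodes telescopes. -/
theorem div_sqrt_max_le {x z : ℝ} (hx : 0 ≤ x) (hz : 0 ≤ z) (hz1 : z ≤ 1) :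
    z / √(max x 1) ≤ (1 + √2) * (√(x + z) - √x) := by
  set m := max x 1 with hm
  have hm1 : 1 ≤ m := le_max_right _ _
  have hxm : x ≤ m := le_max_left _ _
  have h1 : √(x + z) ≤ √2 * √m := by
    rw [← Real.sqrt_mul (by norm_num)]
    exact Real.sqrt_le_sqrt (by linarith)
  have h2 : √x ≤ √m := Real.sqrt_le_sqrt hxm
  have h3 : √x ≤ √(x + z) := Real.sqrt_le_sqrt (by linarith)
  have h4 : (√(x + z) - √x) * (√(x + z) + √x) = z := by
    have := Real.sq_sqrt hx
    have := Real.sq_sqrt (add_nonneg hx hz)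
    nlinarith
  have hm0 : 0 < √m := Real.sqrt_pos.2 (by linarith)
  rw [div_le_iff₀ hm0]
  calc z = (√(x + z) - √x) * (√(x + z) + √x) := h4.symm
    _ ≤ (√(x + z) - √x) * ((1 + √2) * √m) :=
        mul_le_mul_of_nonneg_left (by linarith) (by linarith)
    _ = _ := by ring

theorem sum_div_sqrt_le {q : ℕ → ℝ} (hq : ∀ u, 0 ≤ q u ∧ q u ≤ 1) (T : ℕ) :
    ∑ t ∈ Finset.range T, q t / √(max (∑ u ∈ Finset.range t, q u) 1) ≤
      (1 + √2) * √(∑ u ∈ Finset.range T, q u) := by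
  induction T with
  | zero => simp
  | succ T ih =>
    rw [Finset.sum_range_succ, Finset.sum_range_succ]
    have := div_sqrt_max_le (Finset.sum_nonneg fun u _ => (hq u).1) (hq T).1 (hq T).2
      (x := ∑ u ∈ Finset.range T, q u)
    linarith

/-- Random counts are exchanged for pseudo-counts `m`. If `m ≤ 4L`, the right side is at least `1`,
which bounds every width; otherwise `n ≥ m/2 - L ≥ m/4`. -/
theorem width_le {S A : Type*} [DecidableEq S] [DecidableEq A] {H t : ℕ} {β : ℕ → ℝ}
    {D : Dataset S A H t} {h : Fin H} {s : S} {a : A} {m L b : ℝ} (hL : 1 ≤ L) (hLb : L ≤ b)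
    (hβ : β (count D h s a) ≤ b) (hm : m / 2 - count D h s a ≤ L) :
    width β D h s a ≤ 2 * √b * (1 / √(max m 1)) := by
  have hM : 0 < max m 1 := lt_max_of_lt_right one_pos
  have e : 2 * √b * (1 / √(max m 1)) = √(4 * b / max m 1) := by
    rw [Real.sqrt_div (by linarith), Real.sqrt_mul (by norm_num),
      show (4 : ℝ) = 2 ^ 2 by norm_num, Real.sqrt_sq (by norm_num)]
    ring
  have hone : m ≤ 4 * L → 1 ≤ 4 * b / max m 1 := fun h => by
    rw [one_le_div hM]
    exact max_le (by linarith) (by linarith)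
  rw [e, width]
  split_ifs with hn
  · rw [hn] at hm
    exact Real.one_le_sqrt.2 (hone (by push_cast at hm; linarith))
  · refine Real.sqrt_le_sqrt ?_
    by_cases hm4 : m ≤ 4 * L
    · exact (min_le_right _ _).trans (hone hm4)
    · have hn0 : (0 : ℝ) < count D h s a := by exact_mod_cast Nat.pos_of_ne_zero hn
      refine (min_le_left _ _).trans ?_
      rw [max_eq_left (by linarith), div_le_div_iff₀ hn0 (by linarith)]
      have h1 : m ≤ 4 * count D h s a := by linarith
      nlinarith

variable {S A : Type*} [Fintype S] [DecidableEq S] [Fintype A] [DecidableEq A] {H : ℕ}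

theorem sum_pseudoCount (alg : Algorithm S A H) (M : Transitions S A H) (s₁ : S)
    (ω : ℕ → Episode S A H) (t : ℕ) (h : Fin H) :
    ∑ s, ∑ a, pseudoCount alg M s₁ ω t h s a = t := by
  have e : ∀ s, ∑ a, pseudoCount alg M s₁ ω t h s a =
      ∑ u ∈ Finset.range t, ∑ a, visitProb M s₁ (alg.policy u (dataset ω u)) h s a :=
    fun s => Finset.sum_comm
  simp only [e]
  rw [Finset.sum_comm]
  simp [sum_visitProb]

theorem sum_sqrt_pseudoCount_le (alg : Algorithm S A H) (M : Transitions S A H) (s₁ : S)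
    (ω : ℕ → Episode S A H) (t : ℕ) (h : Fin H) :
    ∑ s, ∑ a, √(pseudoCount alg M s₁ ω t h s a) ≤ √(Fintype.card S * Fintype.card A * t) := by
  refine Real.le_sqrt_of_sq_le ?_
  have h0 : ∀ s a, 0 ≤ pseudoCount alg M s₁ ω t h s a := fun s a =>
    Finset.sum_nonneg fun u _ => visitProb_nonneg _ _ _ _ _ _
  have := sq_sum_le_card_mul_sum_sq (s := (Finset.univ : Finset (S × A)))
    (f := fun x => √(pseudoCount alg M s₁ ω t h x.1 x.2))
  simp only [Real.sq_sqrt (h0 _ _), Finset.card_univ, Fintype.card_prod, Nat.cast_mul] at this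
  rw [Fintype.sum_prod_type, Fintype.sum_prod_type, sum_pseudoCount] at this
  exact this

theorem sum_visitProb_mul_width_le (alg : Algorithm S A H) (M : Transitions S A H) (s₁ : S)
    {ω : ℕ → Episode S A H} {β : ℕ → ℝ} (hβ : Monotone β) {L : ℝ} (hL : 1 ≤ L)
    (hLβ : ∀ n, L ≤ β n) (T : ℕ) (h : Fin H)
    (hω : ∀ t s a, pseudoCount alg M s₁ ω t h s a / 2 - count (dataset ω t) h s a ≤ L) :
    ∑ t ∈ Finset.range T, ∑ s, ∑ a, visitProb M s₁ (alg.policy t (dataset ω t)) h s a *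
        width β (dataset ω t) h s a ≤
      2 * √(β T) * (1 + √2) * √(Fintype.card S * Fintype.card A * T) := by
  calc _ ≤ ∑ t ∈ Finset.range T, ∑ s, ∑ a, 2 * √(β T) *
        (visitProb M s₁ (alg.policy t (dataset ω t)) h s a /
          √(max (pseudoCount alg M s₁ ω t h s a) 1)) := by
        refine Finset.sum_le_sum fun t ht => Finset.sum_le_sum fun s _ =>
          Finset.sum_le_sum fun a _ => ?_
        have h1 := width_le (D := dataset ω t) hL (hLβ T)
          (hβ ((count_le (dataset ω t) h s a).trans (Finset.mem_range.1 ht).le)) (hω t s a)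
        refine (mul_le_mul_of_nonneg_left h1 (visitProb_nonneg _ _ _ _ _ _)).trans_eq ?_
        ring
    _ = 2 * √(β T) * ∑ s, ∑ a, ∑ t ∈ Finset.range T,
        visitProb M s₁ (alg.policy t (dataset ω t)) h s a /
          √(max (pseudoCount alg M s₁ ω t h s a) 1) := by
        rw [Finset.sum_comm]
        simp only [Finset.mul_sum]
        exact Finset.sum_congr rfl fun s _ => Finset.sum_comm
    _ ≤ 2 * √(β T) * ∑ s, ∑ a, (1 + √2) * √(pseudoCount alg M s₁ ω T h s a) := by
        refine mul_le_mul_of_nonneg_left (Finset.sum_le_sum fun s _ =>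
          Finset.sum_le_sum fun a _ => ?_) (by positivity)
        exact sum_div_sqrt_le (fun u => ⟨visitProb_nonneg _ _ _ _ _ _, visitProb_le_one _ _ _ _ _ _⟩) T
    _ = 2 * √(β T) * (1 + √2) * ∑ s, ∑ a, √(pseudoCount alg M s₁ ω T h s a) := by
        simp only [← Finset.mul_sum]
        ring
    _ ≤ _ := mul_le_mul_of_nonneg_left (sum_sqrt_pseudoCount_le alg M s₁ ω T h) (by positivity)

/-- As long as the error bounds at the initial state are large, the number of episodes is
controlled by the threshold. -/
theorem mul_sq_le_threshold [Nonempty A] {γ : ℝ} (hγ : 0 ≤ γ) (hγ1 : γ ≤ 1)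
    (alg : Algorithm S A H) (M : Transitions S A H) (s₁ : S) {ε : ℝ} (hε : 0 < ε)
    {ω : ℕ → Episode S A H} {β : ℕ → ℝ} (hβ : Monotone β) {L : ℝ} (hL : 1 ≤ L)
    (hLβ : ∀ n, L ≤ β n)
    (hgreedy : ∀ t h s b, errorBound γ β (dataset ω t) h.castSucc s b ≤
      errorBound γ β (dataset ω t) h.castSucc s (alg.policy t (dataset ω t) h s))
    (hacc : ∀ t, Accurate M β (dataset ω t))
    (hω : ∀ t h s a, pseudoCount alg M s₁ ω t h s a / 2 - count (dataset ω t) h s a ≤ L)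
    {T : ℕ} (hT : ∀ t < T, ε / 2 ≤ ⨆ b, errorBound γ β (dataset ω t) 0 s₁ b) :
    T * ε ^ 2 ≤ constC γ H * Fintype.card S * Fintype.card A * β T := by
  rcases Nat.eq_zero_or_pos T with rfl | hTpos
  · have := hL.trans (hLβ 0)
    have := sigma_nonneg hγ H
    simp only [constC, Nat.cast_zero, zero_mul]
    positivity
  set N : ℝ := Fintype.card S * Fintype.card A
  have hT0 : (0 : ℝ) < T := by exact_mod_cast hTpos
  have hσ := sigma_nonneg hγ H
  have hβT : 0 ≤ β T := by linarith [hLβ T]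
  -- The second factor `sigma γ H` is the sum of the discounts `γ^h` over the steps; the bound on
  -- the widths does not depend on the step.
  have h1 : T * (ε / 2) ≤ sigma γ H * √8 *
      (sigma γ H * (2 * √(β T) * (1 + √2) * √(N * T))) := by
    calc (T : ℝ) * (ε / 2) = ∑ _t ∈ Finset.range T, ε / 2 := by simp
      _ ≤ ∑ t ∈ Finset.range T, sigma γ H * √8 * ∑ h : Fin H, γ ^ (h : ℕ) * ∑ s, ∑ a,
          visitProb M s₁ (alg.policy t (dataset ω t)) h s a * width β (dataset ω t) h s a :=
        Finset.sum_le_sum fun t ht => (hT t (Finset.mem_range.1 ht)).trans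
          ((hacc t).iSup_errorBound_le_sum hγ hγ1 (hgreedy t) s₁)
      _ = sigma γ H * √8 * ∑ h : Fin H, γ ^ (h : ℕ) * ∑ t ∈ Finset.range T, ∑ s, ∑ a,
          visitProb M s₁ (alg.policy t (dataset ω t)) h s a * width β (dataset ω t) h s a := by
        rw [← Finset.mul_sum, Finset.sum_comm]
        simp only [← Finset.mul_sum]
      _ ≤ sigma γ H * √8 * ∑ h : Fin H, γ ^ (h : ℕ) *
          (2 * √(β T) * (1 + √2) * √(N * T)) := by
        gcongr with h _
        exact sum_visitProb_mul_width_le alg M s₁ hβ hL hLβ T h fun t s a => hω t h s a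
      _ = _ := by
        rw [← Finset.sum_mul, sigma, Fin.sum_univ_eq_sum_range (fun i => γ ^ i) H]
  have h2 := pow_le_pow_left₀ (by positivity) h1 2
  have h3 : (sigma γ H * √8 * (sigma γ H * (2 * √(β T) * (1 + √2) * √(N * T)))) ^ 2 =
      T * (32 * (1 + √2) ^ 2 * sigma γ H ^ 4 * N * β T) := by
    have e1 : √8 ^ 2 = 8 := Real.sq_sqrt (by norm_num)
    have e2 : √(β T) ^ 2 = β T := Real.sq_sqrt hβT
    have e3 : √(N * T) ^ 2 = N * T := Real.sq_sqrt (by positivity)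
    calc _ = sigma γ H ^ 4 * √8 ^ 2 * 4 * √(β T) ^ 2 * (1 + √2) ^ 2 * √(N * T) ^ 2 := by ring
      _ = _ := by rw [e1, e2, e3]; ring
  rw [h3] at h2
  -- Squaring gives the constant `4 · 32 = 128`, which is below the `144` of `constC`.
  have h4 : (T : ℝ) * (T * ε ^ 2) ≤ T * (128 * (1 + √2) ^ 2 * sigma γ H ^ 4 * N * β T) := by
    nlinarith
  have h5 := le_of_mul_le_mul_left h4 hT0
  have h6 : 0 ≤ (1 + √2) ^ 2 * sigma γ H ^ 4 * N * β T := by positivity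
  calc (T : ℝ) * ε ^ 2 ≤ 144 * ((1 + √2) ^ 2 * sigma γ H ^ 4 * N * β T) := by linarith
    _ = _ := by simp only [constC, N]; ring

end SumOfWidths

/-! ### Solving for the number of episodes and simplifying the bound -/

section Bounds

theorem threshold_mono {S A H : ℕ} (hS : 1 ≤ S) (δ : ℝ) : Monotone (threshold S A H δ) := by
  intro m n hmn
  have h1 : (0 : ℝ) ≤ S - 1 := by
    have : (1 : ℝ) ≤ S := by exact_mod_cast hS
    linarith
  unfold threshold
  gcongr

theorem le_threshold {S A H : ℕ} (hS : 1 ≤ S) (δ : ℝ) (n : ℕ) :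
    Real.log (2 * S * A * H / δ) ≤ threshold S A H δ n := by
  have h1 : (0 : ℝ) ≤ S - 1 := by
    have : (1 : ℝ) ≤ S := by exact_mod_cast hS
    linarith
  refine (le_trans ?_ (threshold_mono hS δ (Nat.zero_le n)))
  simp [threshold, h1]

theorem one_le_log {S A H : ℕ} {δ : ℝ} (hS : 1 ≤ S) (hA : 2 ≤ A) (hH : 1 ≤ H) (hδ : 0 < δ)
    (hδ1 : δ < 1) : 1 ≤ Real.log (2 * S * A * H / δ) := by
  have hS' : (1 : ℝ) ≤ S := by exact_mod_cast hS
  have hA' : (2 : ℝ) ≤ A := by exact_mod_cast hA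
  have hH' : (1 : ℝ) ≤ H := by exact_mod_cast hH
  have h1 : (4 : ℝ) ≤ 2 * S * A * H := by
    have : (2 : ℝ) ≤ S * A := by nlinarith
    nlinarith
  rw [Real.le_log_iff_exp_le (by positivity), le_div_iff₀ hδ]
  nlinarith [Real.exp_one_lt_d9, Real.exp_pos 1]

/-- From `log x ≤ x - 1` at `x = √y / e`, one gets `log y ≤ (2/e) √y`, and `2/e < 3/4`. A constant
strictly below `1` leaves room to absorb the `1` in `1 + T / k` later. -/
theorem log_le_sqrt {y : ℝ} (hy : 0 < y) : Real.log y ≤ 3 / 4 * √y := by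
  have h0 := Real.sqrt_pos.2 hy
  have h1 := Real.log_le_sub_one_of_pos (div_pos h0 (Real.exp_pos 1))
  rw [Real.log_div h0.ne' (Real.exp_pos 1).ne', Real.log_exp, Real.log_sqrt hy.le] at h1
  have h2 : √y / Real.exp 1 ≤ 3 / 8 * √y := by
    rw [div_le_iff₀ (Real.exp_pos 1)]
    nlinarith [Real.exp_one_gt_d9]
  linarith

/-- This crude bound is meant to be put back inside the logarithm. Bounding the logarithm by a
square root makes the right side of the hypothesis linear in `√T`, and dividing by `√T` bounds `√T`
itself. -/
theorem one_add_div_le_sq {T k K L : ℝ} (hT : T = 0 ∨ 1 ≤ T) (hk : 1 ≤ k) (hK : 1 ≤ K) (hL : 1 ≤ L)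
    (h : T ≤ K * (L + k * Real.log (Real.exp 1 * (1 + T / k)))) :
    1 + T / k ≤ (K * (L + k * (√(Real.exp 1) + √(Real.exp 1 / k)))) ^ 2 := by
  set c := √(Real.exp 1) with hc
  have hk0 : 0 < k := by linarith
  have hc1 : 1 ≤ c := Real.one_le_sqrt.2 (by linarith [Real.exp_one_gt_d9])
  have hsk : 1 ≤ √k := Real.one_le_sqrt.2 hk
  have hsk2 : √k ^ 2 = k := Real.sq_sqrt hk0.le
  have e1 : k * (c + √(Real.exp 1 / k)) = c * (k + √k) := by
    rw [Real.sqrt_div (Real.exp_pos 1).le, ← hc]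
    have : k / √k = √k := Real.div_sqrt
    calc k * (c + c / √k) = c * (k + k / √k) := by ring
      _ = _ := by rw [this]
  rw [e1]
  set a := c * (k + √k) with ha
  have ha2 : 2 ≤ a := by nlinarith
  rcases hT with rfl | hT
  · have : 1 ≤ K * (L + a) := by nlinarith
    rw [zero_div, add_zero]
    exact one_le_pow₀ this
  · have hs1 : 1 ≤ √T := Real.one_le_sqrt.2 hT
    have hs2 : √T ^ 2 = T := Real.sq_sqrt (by linarith)
    have h1 : k * Real.log (Real.exp 1 * (1 + T / k)) ≤ 3 / 4 * a * √T := by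
      have h2 := log_le_sqrt (y := Real.exp 1 * (1 + T / k)) (by positivity)
      have h3 : √(Real.exp 1 * (1 + T / k)) ≤ c * (1 + √T / √k) := by
        rw [Real.sqrt_mul (Real.exp_pos 1).le, ← hc, ← Real.sqrt_div (by linarith)]
        gcongr
        have : 0 ≤ T / k := by positivity
        refine Real.sqrt_le_iff.2 ⟨by positivity, ?_⟩
        nlinarith [Real.sq_sqrt this, Real.sqrt_nonneg (T / k)]
      have h4 : k * (c * (1 + √T / √k)) = c * (k + √k * √T) := by
        have : k / √k = √k := Real.div_sqrt
        calc k * (c * (1 + √T / √k)) = c * (k + k / √k * √T) := by ring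
          _ = _ := by rw [this]
      have h5 : c * (k + √k * √T) ≤ a * √T := by
        rw [ha]
        have : k ≤ k * √T := le_mul_of_one_le_right hk0.le hs1
        nlinarith
      calc k * Real.log (Real.exp 1 * (1 + T / k)) ≤ k * (3 / 4 * (c * (1 + √T / √k))) := by
            gcongr
            linarith
        _ = 3 / 4 * (k * (c * (1 + √T / √k))) := by ring
        _ ≤ _ := by rw [h4]; linarith
    have h6 : √T * √T ≤ K * (L + 3 / 4 * a) * √T := by
      have h7 : L ≤ L * √T := le_mul_of_one_le_right (by linarith) hs1
      have h8 : K * (L + k * Real.log (Real.exp 1 * (1 + T / k))) ≤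
          K * (L * √T + 3 / 4 * a * √T) :=
        mul_le_mul_of_nonneg_left (by linarith) (by linarith)
      nlinarith
    have h9 : √T ≤ K * (L + 3 / 4 * a) := le_of_mul_le_mul_right h6 (by linarith)
    have h10 : T ≤ (K * (L + 3 / 4 * a)) ^ 2 := by
      rw [← hs2]; exact pow_le_pow_left₀ (by linarith) h9 2
    have h11 : T / k ≤ T := div_le_self (by linarith) hk
    -- The slack between `3/4` and `1`, with `a ≥ 2` and `L ≥ 1`, covers the additive `1`.
    have h12 : 1 + (L + 3 / 4 * a) ^ 2 ≤ (L + a) ^ 2 := by nlinarith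
    have h13 : 1 ≤ K ^ 2 := one_le_pow₀ hK
    calc 1 + T / k ≤ K ^ 2 * 1 + K ^ 2 * (L + 3 / 4 * a) ^ 2 := by nlinarith
      _ ≤ _ := by rw [mul_pow]; nlinarith

/-- An explicit bound for the solutions `T` of `T ε² ≤ C_H S A β(T)`. -/
theorem le_sampleBound {S A H : ℕ} {γ ε δ : ℝ} (hS : 1 ≤ S) (hε : 0 < ε)
    (hL : 1 ≤ Real.log (2 * S * A * H / δ)) (hK : ε ^ 2 ≤ constC γ H * S * A) {T : ℕ}
    (hT : T * ε ^ 2 ≤ constC γ H * S * A * threshold S A H δ T) :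
    (T : ℝ) ≤ sampleBound S A H γ ε δ := by
  have hε2 : 0 < ε ^ 2 := by positivity
  have hT' : (T : ℝ) ≤ constC γ H * S * A / ε ^ 2 * threshold S A H δ T := by
    rw [div_mul_eq_mul_div, le_div_iff₀ hε2]; exact hT
  have hK' : 1 ≤ constC γ H * S * A / ε ^ 2 := (one_le_div hε2).2 hK
  unfold sampleBound
  unfold threshold at hT'
  set K := constC γ H * S * A / ε ^ 2
  set L := Real.log (2 * S * A * H / δ)
  rcases hS.eq_or_lt with rfl | hS2
  · simpa using hT'
  have hk : (1 : ℝ) ≤ S - 1 := by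
    have : (2 : ℝ) ≤ S := by exact_mod_cast hS2
    linarith
  set k := (S : ℝ) - 1
  have hTn : (T : ℝ) = 0 ∨ 1 ≤ (T : ℝ) := by
    rcases Nat.eq_zero_or_pos T with rfl | h
    · left; simp
    · right; exact_mod_cast h
  have h1 := one_add_div_le_sq hTn hk hK' hL hT'
  set Y := K * (L + k * (√(Real.exp 1) + √(Real.exp 1 / k)))
  have hpos : 0 < 1 + (T : ℝ) / k := by positivity
  have h2 := Real.log_le_log hpos h1
  rw [Real.log_pow] at h2
  push_cast at h2
  rw [Real.log_mul (Real.exp_pos 1).ne' hpos.ne', Real.log_exp] at hT'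
  refine hT'.trans ?_
  -- The square in the crude bound becomes the factor `2` of the logarithm.
  have h3 : k * (1 + Real.log (1 + T / k)) ≤ 2 * k * Real.log Y + k := by nlinarith
  exact mul_le_mul_of_nonneg_left (by linarith) (by linarith)

theorem constC_le {γ : ℝ} (hγ : 0 ≤ γ) (hγ1 : γ ≤ 1) (H : ℕ) : constC γ H ≤ 840 * (H : ℝ) ^ 4 := by
  have h1 : (1 + √2) ^ 2 ≤ 35 / 6 := by
    have h2 : √2 ^ 2 = 2 := Real.sq_sqrt (by norm_num)
    have h3 : √2 ≤ 17 / 12 := Real.sqrt_le_iff.2 ⟨by norm_num, by norm_num⟩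
    nlinarith
  have h2 := pow_le_pow_left₀ (sigma_nonneg hγ H) (sigma_le hγ hγ1 H) 4
  have h3 := pow_nonneg (sigma_nonneg hγ H) 4
  unfold constC
  nlinarith

theorem sampleBound_le {S A H : ℕ} {γ ε δ : ℝ} (hS : 1 ≤ S) (hA : 2 ≤ A) (hH : 1 ≤ H) (hε : 0 < ε)
    (hγ : 0 ≤ γ) (hγ1 : γ ≤ 1) (hL : 1 ≤ Real.log (2 * S * A * H / δ)) (hεH : ε ≤ H) :
    sampleBound S A H γ ε δ ≤ 10 ^ 5 * ((S * A * H ^ 4 / ε ^ 2) * Real.log (2 * S * A * H / δ) +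
      ((S : ℝ) ^ 2 * A * H ^ 4 / ε ^ 2) *
        Real.log (S * A * H ^ 4 / ε ^ 2 * Real.log (2 * S * A * H / δ))) := by
  have hS' : (1 : ℝ) ≤ S := by exact_mod_cast hS
  have hA' : (2 : ℝ) ≤ A := by exact_mod_cast hA
  have hH' : (1 : ℝ) ≤ H := by exact_mod_cast hH
  have hε2 : 0 < ε ^ 2 := by positivity
  have hσ := one_le_sigma hγ (show 0 < H by omega)
  have hC : 0 < constC γ H := by unfold constC; positivity
  have eX : (S : ℝ) ^ 2 * A * H ^ 4 / ε ^ 2 = S * (S * A * H ^ 4 / ε ^ 2) := by ring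
  rw [eX]
  unfold sampleBound
  set L := Real.log (2 * S * A * H / δ)
  set X : ℝ := S * A * H ^ 4 / ε ^ 2 with hX
  set K := constC γ H * S * A / ε ^ 2 with hKdef
  have hK0 : 0 < K := by positivity
  have hKX : K ≤ 840 * X := by
    rw [hKdef, hX, ← mul_div_assoc]
    refine div_le_div_of_nonneg_right ?_ hε2.le
    have := mul_le_mul_of_nonneg_right (constC_le hγ hγ1 H)
      (show (0 : ℝ) ≤ S * A by positivity)
    linarith
  have hX2 : 2 * S ≤ X := by
    rw [hX, le_div_iff₀ hε2]
    have h1 : ε ^ 2 ≤ H ^ 2 := pow_le_pow_left₀ hε.le hεH 2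
    have h2 : (H : ℝ) ^ 2 ≤ H ^ 4 := pow_le_pow_right₀ hH' (by norm_num)
    calc 2 * S * ε ^ 2 ≤ (A * S) * H ^ 4 := by gcongr; linarith
      _ = _ := by ring
  have hX0 : 0 < X := by linarith
  have hXL : X ≤ X * L := le_mul_of_one_le_right hX0.le hL
  have hl0 : 0 ≤ Real.log (X * L) := Real.log_nonneg (by linarith)
  rcases hS.eq_or_lt with hS1 | hS2
  · have e1 : (S : ℝ) - 1 = 0 := by rw [← hS1]; simp
    rw [e1]
    simp only [zero_mul, mul_zero, add_zero]
    have h1 : K * L ≤ 840 * X * L := mul_le_mul_of_nonneg_right hKX (by linarith)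
    have h2 : 0 ≤ S * X * Real.log (X * L) := by positivity
    have h3 : 0 ≤ X * L := by positivity
    linarith
  have hS2' : (2 : ℝ) ≤ S := by exact_mod_cast hS2
  set k := (S : ℝ) - 1 with hk
  have hk1 : 1 ≤ k := by linarith
  set l := Real.log (X * L) with hl
  have hl2 : 2 * Real.log 2 ≤ l := by
    rw [hl, show 2 * Real.log 2 = Real.log (2 ^ 2) by rw [Real.log_pow]; norm_num]
    exact Real.log_le_log (by norm_num) (by linarith)
  set Y := L + k * (√(Real.exp 1) + √(Real.exp 1 / k)) with hY
  have hY0 : 0 < Y := by positivity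
  have hYle : Y ≤ 4 * S * L := by
    have h1 : √(Real.exp 1) ≤ 2 :=
      Real.sqrt_le_iff.2 ⟨by norm_num, by linarith [Real.exp_one_lt_d9]⟩
    have h2 : √(Real.exp 1 / k) ≤ 2 := by
      refine (Real.sqrt_le_sqrt ?_).trans h1
      exact div_le_self (Real.exp_pos 1).le hk1
    have h3 : k * (√(Real.exp 1) + √(Real.exp 1 / k)) ≤ k * 4 :=
      mul_le_mul_of_nonneg_left (by linarith) (by linarith)
    have h4 : k * 4 ≤ k * 4 * L := le_mul_of_one_le_right (by linarith) hL
    have h5 : k * 4 * L = 4 * S * L - 4 * L := by rw [hk]; ring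
    linarith
  have hKY : K * Y ≤ 2 ^ 11 * (X * L) ^ 2 := by
    calc K * Y ≤ 840 * X * (4 * S * L) := by gcongr
      _ = 1680 * (2 * S) * (X * L) := by ring
      _ ≤ 1680 * (X * L) * (X * L) := by
          have : 2 * (S : ℝ) ≤ X * L := hX2.trans hXL
          gcongr
      _ ≤ _ := by nlinarith [sq_nonneg (X * L)]
  -- Since `X L ≥ 2S ≥ 4`, we have `2 log 2 ≤ l`, so that `11 log 2 + 2 l ≤ (11/2 + 2) l`.
  have hlog : Real.log (K * Y) ≤ 15 / 2 * l := by
    have h1 := Real.log_le_log (by positivity) hKY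
    rw [Real.log_mul (x := 2 ^ 11) (by positivity) (by positivity), Real.log_pow,
      Real.log_pow] at h1
    push_cast at h1
    linarith
  have hl1 : 1 ≤ l := by linarith [Real.log_two_gt_d9]
  have hbr : L + 2 * k * Real.log (K * Y) + k ≤ L + 16 * (S * l) := by
    have h1 : 2 * k * Real.log (K * Y) ≤ 2 * k * (15 / 2 * l) :=
      mul_le_mul_of_nonneg_left hlog (by linarith)
    have h2 : k ≤ k * l := le_mul_of_one_le_right (by linarith) hl1
    have h3 : k * l = S * l - l := by rw [hk]; ring
    linarith
  have hSl : 0 ≤ S * l := by positivity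
  calc K * (L + 2 * k * Real.log (K * Y) + k) ≤ K * (L + 16 * (S * l)) := by gcongr
    _ ≤ 840 * X * (L + 16 * (S * l)) := by gcongr
    _ ≤ 10 ^ 5 * (X * L + S * X * l) := by
        have h1 : 0 ≤ X * L := by positivity
        have h2 : 0 ≤ S * X * l := by positivity
        have h3 : 840 * X * (L + 16 * (S * l)) = 840 * (X * L) + 13440 * (S * X * l) := by ring
        linarith

end Bounds

/-! ### Stopping on the good event -/

section Main

variable {S A : Type*} [Fintype S] [DecidableEq S] [Fintype A] [DecidableEq A] {H : ℕ} [NeZero H]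
  {γ : ℝ} {β : ℕ → ℝ} {s₁ : S} {ε : ℝ} {alg : Algorithm S A H}

theorem IsRFUCRL.halts_iff_iSup [Nonempty A] (halg : IsRFUCRL γ β s₁ ε alg) {t : ℕ}
    (D : Dataset S A H t) : alg.halts t D ↔ ⨆ b, errorBound γ β D 0 s₁ b ≤ ε / 2 := by
  rw [halg.halts_iff]
  have h0 : (0 : Fin H).castSucc = 0 := by ext; simp
  have h1 := halg.greedy t D 0 s₁
  rw [h0] at h1
  exact ⟨fun h => (ciSup_le h1).trans h, fun h => (le_iSup_errorBound γ β D 0 s₁ _).trans h⟩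

/-- On the good event, Reward-Free UCRL stops, soon if `ε` is not too large, and its final
database allows to plan well. -/
theorem IsRFUCRL.exists_stopsAt {δ : ℝ} (hA : 2 ≤ Fintype.card A) (hγ : 0 ≤ γ) (hγ1 : γ ≤ 1)
    (hε : 0 < ε) (hL : 1 ≤ Real.log (2 * Fintype.card S * Fintype.card A * H / δ))
    (halg : IsRFUCRL γ (threshold (Fintype.card S) (Fintype.card A) H δ) s₁ ε alg)
    (M : Transitions S A H) {ω : ℕ → Episode S A H}
    (hω : ∀ t, Accurate M (threshold (Fintype.card S) (Fintype.card A) H δ) (dataset ω t) ∧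
      ∀ h s a, pseudoCount alg M s₁ ω t h s a / 2 - count (dataset ω t) h s a ≤
        Real.log (2 * Fintype.card S * Fintype.card A * H / δ)) :
    ∃ t : ℕ, StopsAt alg ω t ∧ PlansWell γ M s₁ ε (dataset ω t) ∧
      (ε ^ 2 ≤ constC γ H * Fintype.card S * Fintype.card A →
        (t : ℝ) ≤ sampleBound (Fintype.card S) (Fintype.card A) H γ ε δ) := by
  classical
  have hS : 1 ≤ Fintype.card S := Fintype.card_pos_iff.2 ⟨s₁⟩
  have : Nonempty A := Fintype.card_pos_iff.1 (by omega)
  have hbound : ε ^ 2 ≤ constC γ H * Fintype.card S * Fintype.card A → ∀ T : ℕ,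
      (∀ t < T, ¬ alg.halts t (dataset ω t)) →
        (T : ℝ) ≤ sampleBound (Fintype.card S) (Fintype.card A) H γ ε δ := by
    intro hK T hT
    refine le_sampleBound hS hε hL hK ?_
    refine mul_sq_le_threshold hγ hγ1 alg M s₁ hε (threshold_mono hS δ) hL (le_threshold hS δ)
      (fun t => halg.greedy t (dataset ω t)) (fun t => (hω t).1) (fun t => (hω t).2) ?_
    intro t ht
    have := hT t ht
    rw [halg.halts_iff_iSup] at this
    exact (not_le.1 this).le
  have hex : ∃ t, alg.halts t (dataset ω t) := by
    by_cases hK : ε ^ 2 ≤ constC γ H * Fintype.card S * Fintype.card A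
    · by_contra hne
      push Not at hne
      -- If the algorithm never stopped, the bound would hold for every `T`, in particular for one
      -- that exceeds it.
      have h1 := hbound hK (⌊sampleBound (Fintype.card S) (Fintype.card A) H γ ε δ⌋₊ + 1)
        fun t _ => hne t
      push_cast at h1
      linarith [Nat.lt_floor_add_one (sampleBound (Fintype.card S) (Fintype.card A) H γ ε δ)]
    -- For large `ε` the algorithm stops without data: `Ē_1 ≤ σ_H`, and `4 σ_H² ≤ C_H S A < ε²`
    -- gives `σ_H ≤ ε/2`.
    · refine ⟨0, (halg.halts_iff_iSup _).2 ?_⟩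
      refine (iSup_errorBound_mem_Icc hγ _ _ 0 s₁).2.trans ?_
      rw [Fin.val_zero, Nat.sub_zero]
      have hσ := one_le_sigma hγ (Nat.pos_of_neZero H)
      have hS' : (1 : ℝ) ≤ Fintype.card S := by exact_mod_cast hS
      have hA' : (1 : ℝ) ≤ Fintype.card A := by
        have : (2 : ℝ) ≤ Fintype.card A := by exact_mod_cast hA
        linarith
      have h1 : (2 * sigma γ H) ^ 2 ≤ constC γ H * Fintype.card S * Fintype.card A := by
        have h2 : sigma γ H ^ 2 ≤ sigma γ H ^ 4 := pow_le_pow_right₀ hσ (by norm_num)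
        have h3 : (1 : ℝ) ≤ (1 + √2) ^ 2 := one_le_pow₀ (by linarith [Real.sqrt_nonneg 2])
        have h4 : (2 * sigma γ H) ^ 2 ≤ constC γ H := by
          unfold constC
          nlinarith [pow_nonneg (zero_le_one.trans hσ) 4]
        have h5 : 0 ≤ constC γ H := le_trans (by positivity) h4
        calc (2 * sigma γ H) ^ 2 ≤ constC γ H * 1 * 1 := by linarith
          _ ≤ _ := by gcongr
      have h6 := lt_of_pow_lt_pow_left₀ 2 hε.le (h1.trans_lt (not_le.1 hK))
      linarith
  refine ⟨Nat.find hex, ⟨Nat.find_spec hex, fun u hu => Nat.find_min hex hu⟩, ?_, fun hK =>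
    hbound hK _ fun u hu => Nat.find_min hex hu⟩
  exact (hω _).1.plansWell hγ ((halg.halts_iff_iSup _).1 (Nat.find_spec hex))

end Main

end RewardFree

end

theorem theorem1 {S A : Type*} [Fintype S] [DecidableEq S] [Fintype A] [DecidableEq A]
    (hA : 2 ≤ Fintype.card A) {H : ℕ} [NeZero H] (γ : ℝ) (hγ0 : 0 < γ) (hγ1 : γ ≤ 1) (s₁ : S)
    (ε δ : ℝ) (hε : 0 < ε) (hδ0 : 0 < δ) (hδ1 : δ < 1) (alg : RewardFree.Algorithm S A H)
    (halg : RewardFree.IsRFUCRL γ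
      (RewardFree.threshold (Fintype.card S) (Fintype.card A) H δ) s₁ ε alg) :
    RewardFree.IsPAC γ s₁ ε δ alg ∧
    (ε ^ 2 ≤ RewardFree.constC γ H * Fintype.card S * Fintype.card A →
      ∀ M : RewardFree.Transitions S A H,
        ENNReal.ofReal (1 - δ) ≤ RewardFree.interactionLaw alg M s₁
          {ω | ∃ t : ℕ, RewardFree.StopsAt alg ω t ∧
            RewardFree.PlansWell γ M s₁ ε (RewardFree.dataset ω t) ∧
            (t : ℝ) ≤
              RewardFree.sampleBound (Fintype.card S) (Fintype.card A) H γ ε δ}) ∧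
    (ε ≤ H →
      RewardFree.sampleBound (Fintype.card S) (Fintype.card A) H γ ε δ ≤
        10 ^ 5 *
          ((Fintype.card S * Fintype.card A * H ^ 4 / ε ^ 2) *
              Real.log (2 * Fintype.card S * Fintype.card A * H / δ) +
            ((Fintype.card S : ℝ) ^ 2 * Fintype.card A * H ^ 4 / ε ^ 2) *
              Real.log (Fintype.card S * Fintype.card A * H ^ 4 / ε ^ 2 *
                Real.log (2 * Fintype.card S * Fintype.card A * H / δ)))) := by
  have hS : 1 ≤ Fintype.card S := Fintype.card_pos_iff.2 ⟨s₁⟩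
  have hH : 1 ≤ H := Nat.pos_of_neZero H
  have hL := RewardFree.one_le_log hS hA hH hδ0 hδ1
  have hgood := fun M => RewardFree.measure_good_ge alg M s₁ (by omega) hH hδ0
    (zero_le_one.trans hL)
  refine ⟨fun M => (hgood M).trans (MeasureTheory.measure_mono fun ω hω => ?_),
    fun hK M => (hgood M).trans (MeasureTheory.measure_mono fun ω hω => ?_),
    RewardFree.sampleBound_le hS hA hH hε hγ0.le hγ1 hL⟩
  · obtain ⟨t, h1, h2, -⟩ := halg.exists_stopsAt hA hγ0.le hγ1 hε hL M hω
    exact ⟨t, h1, h2⟩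
  · obtain ⟨t, h1, h2, h3⟩ := halg.exists_stopsAt hA hγ0.le hγ1 hε hL M hω
    exact ⟨t, h1, h2, h3 hK⟩
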